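/- Let $M$ be a connected smooth manifold of dimension $n$ with a smooth (positive definite) Riemannian metric $g$ whose Ricci tensor $\mathsf{Ri}$ is not identically zero, and let $\mathsf{sc}$ be the scalar curvature. We say that $\mathsf{Ri}$ is *recurrent* if there is a smooth one-form $\beta$ on $M$, not identically zero, with $$\mathsf{Ri}_{ij;\ell}=\beta_\ell\,\mathsf{Ri}_{ij},$$ and *quasi Einstein* if there are smooth functions $a,b$ on $M$ and, in a neighbourhood of every point, a nowhere vanishing smooth one-form $\omega$ with $$\mathsf{Ri}=a\,g+b\,\frac{\omega\otimes\omega}{|\omega|^2}.$$ **Theorem.** 1. If $n=3$ and $\mathsf{Ri}$ is recurrent, then $\mathsf{Ri}$ is quasi Einstein. More precisely, $\mathsf{sc}$ vanishes nowhere, and every point of $M$ has an open neighbourhood $U$ with a nowhere vanishing smooth one-form $\omega$ on $U$ such that on $U$ $$\mathsf{Ri}=\frac{\mathsf{sc}}{2}\Big(g-\frac{\omega\otimes\omega}{|\omega|^2}\Big).$$ 2. If $n>3$, then $\mathsf{Ri}$ cannot be both recurrent and quasi Einstein. -/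

import Mathlib

open scoped Manifold ContDiff Bundle Matrix

noncomputable section

namespace RicciGeometry

/-! ## Coordinate expressions on `ℝⁿ`

`G y` is the matrix `(g_{ij}(y))` of a metric in a coordinate system. -/

section Coordinates

variable {n : ℕ}

/-- The partial derivative `∂_i f` at `y`. -/
def pderiv (i : Fin n) (f : EuclideanSpace ℝ (Fin n) → ℝ) (y : EuclideanSpace ℝ (Fin n)) : ℝ :=
  fderiv ℝ f y (EuclideanSpace.single i 1)

/-- The Christoffel symbol `Γ^k_{ij}` of the Levi-Civita connection. -/
def christoffel (G : EuclideanSpace ℝ (Fin n) → Matrix (Fin n) (Fin n) ℝ)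
    (k i j : Fin n) (y : EuclideanSpace ℝ (Fin n)) : ℝ :=
  (1 / 2) * ∑ l, (G y)⁻¹ k l *
    (pderiv i (fun z => G z j l) y + pderiv j (fun z => G z i l) y - pderiv l (fun z => G z i j) y)

/-- The curvature components `R^l_{ijk}`, that is `R(∂_i, ∂_j) ∂_k = R^l_{ijk} ∂_l`, where
`R(X, Y) Z = ∇_X ∇_Y Z - ∇_Y ∇_X Z - ∇_{[X, Y]} Z`. -/
def curvature (G : EuclideanSpace ℝ (Fin n) → Matrix (Fin n) (Fin n) ℝ)
    (l i j k : Fin n) (y : EuclideanSpace ℝ (Fin n)) : ℝ :=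
  pderiv i (christoffel G l j k) y - pderiv j (christoffel G l i k) y +
    ∑ m, (christoffel G l i m y * christoffel G m j k y -
      christoffel G l j m y * christoffel G m i k y)

/-- The Ricci components `Ri_{jk} = R^i_{ijk}` (positive on round spheres). -/
def ricci (G : EuclideanSpace ℝ (Fin n) → Matrix (Fin n) (Fin n) ℝ)
    (j k : Fin n) (y : EuclideanSpace ℝ (Fin n)) : ℝ :=
  ∑ i, curvature G i i j k y

/-- The components `Ri_{ij;l} = (∇_{∂_l} Ri)(∂_i, ∂_j)` of the covariant derivative of the
Ricci tensor. -/
def covDerivRicci (G : EuclideanSpace ℝ (Fin n) → Matrix (Fin n) (Fin n) ℝ)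
    (i j l : Fin n) (y : EuclideanSpace ℝ (Fin n)) : ℝ :=
  pderiv l (ricci G i j) y -
    ∑ m, (christoffel G m l i y * ricci G m j y + christoffel G m l j y * ricci G i m y)

/-- The scalar curvature `sc = g^{ij} Ri_{ij}`. -/
def scalar (G : EuclideanSpace ℝ (Fin n) → Matrix (Fin n) (Fin n) ℝ)
    (y : EuclideanSpace ℝ (Fin n)) : ℝ :=
  ∑ i, ∑ j, (G y)⁻¹ i j * ricci G i j y

end Coordinates

/-! ## Riemannian manifolds

Tensor identities are stated in components, in every chart of the maximal smooth atlas. -/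

section Manifold

variable {n : ℕ} {M : Type*} [TopologicalSpace M] [ChartedSpace (EuclideanSpace ℝ (Fin n)) M]

/-- The coordinate vector `∂_i` of the chart `e` at the point with coordinates `y`. -/
def coordVec (e : OpenPartialHomeomorph M (EuclideanSpace ℝ (Fin n)))
    (i : Fin n) (y : EuclideanSpace ℝ (Fin n)) : TangentSpace (𝓡 n) (e.symm y) :=
  mfderiv (𝓡 n) (𝓡 n) e.symm y (EuclideanSpace.single i (1 : ℝ) : EuclideanSpace ℝ (Fin n))

/-- The component `η_i = η(∂_i)` of a covector field in the chart `e`. -/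
def formCoeff (η : ∀ p : M, TangentSpace (𝓡 n) p →L[ℝ] ℝ)
    (e : OpenPartialHomeomorph M (EuclideanSpace ℝ (Fin n)))
    (i : Fin n) (y : EuclideanSpace ℝ (Fin n)) : ℝ :=
  η (e.symm y) (coordVec e i y)

variable [IsManifold (𝓡 n) ∞ M]

/-- `η` restricts to a smooth one-form on `U`. -/
def SmoothOneFormOn (η : ∀ p : M, TangentSpace (𝓡 n) p →L[ℝ] ℝ) (U : Set M) : Prop :=
  ContMDiffOn (𝓡 n) ((𝓡 n).prod 𝓘(ℝ, EuclideanSpace ℝ (Fin n) →L[ℝ] ℝ)) ∞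
    (fun p => Bundle.TotalSpace.mk' (EuclideanSpace ℝ (Fin n) →L[ℝ] ℝ)
      (E := fun p : M => TangentSpace (𝓡 n) p →L[ℝ] Bundle.Trivial M ℝ p) p (η p)) U

/-- A smooth Riemannian metric on `M`. -/
abbrev Metric (n : ℕ) (M : Type*) [TopologicalSpace M]
    [ChartedSpace (EuclideanSpace ℝ (Fin n)) M] [IsManifold (𝓡 n) ∞ M] :=
  Bundle.ContMDiffRiemannianMetric (𝓡 n) ∞ (EuclideanSpace ℝ (Fin n))
    (fun p : M => TangentSpace (𝓡 n) p)

/-- The matrix `g_{ij} = g(∂_i, ∂_j)` of the metric in the chart `e`. -/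
def metricCoeff (g : Metric n M) (e : OpenPartialHomeomorph M (EuclideanSpace ℝ (Fin n)))
    (y : EuclideanSpace ℝ (Fin n)) : Matrix (Fin n) (Fin n) ℝ :=
  Matrix.of fun i j => g.inner (e.symm y) (coordVec e i y) (coordVec e j y)

/-- `|η|² = g^{ij} η_i η_j`, computed in the chart `e`. -/
def formNormSq (g : Metric n M) (η : ∀ p : M, TangentSpace (𝓡 n) p →L[ℝ] ℝ)
    (e : OpenPartialHomeomorph M (EuclideanSpace ℝ (Fin n)))
    (y : EuclideanSpace ℝ (Fin n)) : ℝ :=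
  ∑ i, ∑ j, (metricCoeff g e y)⁻¹ i j * formCoeff η e i y * formCoeff η e j y

/-- The scalar curvature as a function on `M`; its value does not depend on the chart used to
compute it. -/
def scalarCurvature (g : Metric n M) (p : M) : ℝ :=
  scalar (metricCoeff g (chartAt (EuclideanSpace ℝ (Fin n)) p))
    (chartAt (EuclideanSpace ℝ (Fin n)) p p)

/-- The Ricci tensor is not identically zero. -/
def RicciNonzero (g : Metric n M) : Prop :=
  ∃ e ∈ IsManifold.maximalAtlas (𝓡 n) ∞ M, ∃ y ∈ e.target, ∃ i j,
    ricci (metricCoeff g e) i j y ≠ 0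

/-- Ricci recurrent: `Ri_{ij;l} = β_l Ri_{ij}` for a smooth one-form `β` on `M` that is not
identically zero. -/
def RicciRecurrent (g : Metric n M) : Prop :=
  ∃ β : ∀ p : M, TangentSpace (𝓡 n) p →L[ℝ] ℝ,
    SmoothOneFormOn β Set.univ ∧ (∃ p, β p ≠ 0) ∧
    ∀ e ∈ IsManifold.maximalAtlas (𝓡 n) ∞ M, ∀ y ∈ e.target, ∀ i j l,
      covDerivRicci (metricCoeff g e) i j l y =
        formCoeff β e l y * ricci (metricCoeff g e) i j y

/-- Quasi Einstein: `Ri = a g + b (η ⊗ η) / |η|²` with smooth functions `a`, `b` on `M`. Only the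
line spanned by `η` enters, so the nowhere vanishing smooth one-form `η` is asked for in a
neighbourhood of each point: on all of `M` it may exist only up to sign. -/
def QuasiEinstein (g : Metric n M) : Prop :=
  ∃ a b : M → ℝ, ContMDiff (𝓡 n) 𝓘(ℝ) ∞ a ∧ ContMDiff (𝓡 n) 𝓘(ℝ) ∞ b ∧
    ∀ p : M, ∃ U : Set M, IsOpen U ∧ p ∈ U ∧
      ∃ η : ∀ q : M, TangentSpace (𝓡 n) q →L[ℝ] ℝ,
        SmoothOneFormOn η U ∧ (∀ q ∈ U, η q ≠ 0) ∧
        ∀ e ∈ IsManifold.maximalAtlas (𝓡 n) ∞ M, ∀ y ∈ e.target, e.symm y ∈ U → ∀ i j,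
          ricci (metricCoeff g e) i j y =
            a (e.symm y) * metricCoeff g e y i j +
              b (e.symm y) * (formCoeff η e i y * formCoeff η e j y / formNormSq g η e y)

end Manifold

end RicciGeometry

end

open scoped Topology

noncomputable section

namespace RicciGeometry

/-! ## Calculus of matrix-valued functions -/

section MatrixCalculus

variable {n : ℕ} {U : Set (EuclideanSpace ℝ (Fin n))} {y : EuclideanSpace ℝ (Fin n)}

/-! Recurrence makes the Ricci tensor parallel up to scale. From `∇Ri = β ⊗ Ri` one gets `d|Ri|² =
2β|Ri|²`, a homogeneous linear equation along curves, so on a connected manifold `Ri` vanishes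
nowhere (`RecurrentWith.ricciNormSq_ne_zero`). Hence `Ri/|Ri|` is a parallel symmetric form, and
every curvature operator annihilates it, and `Ri` with it (`RecurrentOn.curv_ricMat`). Moreover `d
sc = β sc`, and the contracted Bianchi identity `d sc = 2 div Ri` then reads `sc β = 2 Ri(β)`
(`RecurrentOn.eigen`). The rest is linear algebra at a point.

In an orthonormal frame diagonalizing `Ri`, with eigenvalues `λ` and sectional curvatures `K`,
annihilation gives `K_ab (λ_a - λ_b) = 0`, while `λ_b = ∑ K_ab` (`exists_sectional`). For `n = 3`
these equations leave two cases: all eigenvalues are equal, or they are `(sc/2, sc/2, 0)` with `sc ≠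
0`. Where `β ≠ 0` the first is impossible, since `Ri = λ g` turns the eigenvector equation into `3λβ
= 2λβ`. The quantity `3|Ri|² - sc²`, which vanishes exactly in the first case, is also multiplied by
`2β` under differentiation, so the second case holds everywhere. The unit covector `w` of the null
line is fixed up to sign, and `w ⊗ w = g - (2/sc) Ri` is smooth; a nonzero column of it is a smooth
multiple of `w`.

For `n > 3` suppose `Ri = a g + b η ⊗ η` at a point where `β ≠ 0`. If `b η ⊗ η = 0`, the eigenvector
equation gives `(n - 2) a = 0`. Otherwise the curvature kills `η`, so `Ri(η) = 0` and `sc = (n - 1)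
a`; the eigenvector equation first makes `β` orthogonal to `η` and then gives `(n - 1) a = 2a`,
which is impossible (`ricci_eq_zero_of_quasiEinstein`).

The identities are proved for matrix-valued functions on open sets of `ℝⁿ`. Independence of the
chart comes from uniqueness of the Levi-Civita connection and gauge covariance of curvature. -/

theorem pderiv_congr {f h : EuclideanSpace ℝ (Fin n) → ℝ} (hU : IsOpen U) (hy : y ∈ U)
    (hfh : Set.EqOn f h U) (i : Fin n) : pderiv i f y = pderiv i h y := by
  unfold pderiv
  rw [(hfh.eventuallyEq_of_mem (hU.mem_nhds hy)).fderiv_eq]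

theorem contDiffOn_differentiableAt {f : EuclideanSpace ℝ (Fin n) → ℝ} (hU : IsOpen U)
    (hy : y ∈ U) (hf : ContDiffOn ℝ ∞ f U) : DifferentiableAt ℝ f y :=
  (hf.contDiffAt (hU.mem_nhds hy)).differentiableAt (by simp)

theorem contDiffOn_pderiv {f : EuclideanSpace ℝ (Fin n) → ℝ} (hU : IsOpen U)
    (hf : ContDiffOn ℝ ∞ f U) (i : Fin n) : ContDiffOn ℝ ∞ (pderiv i f) U :=
  (hf.fderiv_of_isOpen hU (by simp)).clm_apply contDiffOn_const

theorem pderiv_comm {f : EuclideanSpace ℝ (Fin n) → ℝ} (hU : IsOpen U) (hy : y ∈ U)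
    (hf : ContDiffOn ℝ ∞ f U) (i j : Fin n) :
    pderiv i (pderiv j f) y = pderiv j (pderiv i f) y := by
  have hd : DifferentiableAt ℝ (fderiv ℝ f) y :=
    (((hf.fderiv_of_isOpen hU (m := ∞) (by simp)).contDiffAt (hU.mem_nhds hy)).differentiableAt
      (by simp))
  have key : ∀ i j : Fin n, pderiv i (pderiv j f) y =
      fderiv ℝ (fderiv ℝ f) y (EuclideanSpace.single i 1) (EuclideanSpace.single j 1) := by
    intro i j
    change fderiv ℝ (fun z => fderiv ℝ f z (EuclideanSpace.single j 1)) y _ = _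
    rw [fderiv_clm_apply hd (by fun_prop)]
    simp
  rw [key, key]
  have hs : IsSymmSndFDerivAt ℝ f y :=
    (hf.contDiffAt (hU.mem_nhds hy)).isSymmSndFDerivAt (by simp; exact WithTop.coe_le_coe.2 le_top)
  exact hs _ _

theorem pderiv_mul {f h : EuclideanSpace ℝ (Fin n) → ℝ} (hf : DifferentiableAt ℝ f y)
    (hh : DifferentiableAt ℝ h y) (i : Fin n) :
    pderiv i (fun z => f z * h z) y = pderiv i f y * h y + f y * pderiv i h y := by
  unfold pderiv
  rw [fderiv_fun_mul hf hh]
  simp; ring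

theorem pderiv_add {f h : EuclideanSpace ℝ (Fin n) → ℝ} (hf : DifferentiableAt ℝ f y)
    (hh : DifferentiableAt ℝ h y) (i : Fin n) :
    pderiv i (fun z => f z + h z) y = pderiv i f y + pderiv i h y := by
  unfold pderiv
  rw [fderiv_fun_add hf hh]
  simp

theorem pderiv_sub {f h : EuclideanSpace ℝ (Fin n) → ℝ} (hf : DifferentiableAt ℝ f y)
    (hh : DifferentiableAt ℝ h y) (i : Fin n) :
    pderiv i (fun z => f z - h z) y = pderiv i f y - pderiv i h y := by
  unfold pderiv
  rw [fderiv_fun_sub hf hh]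
  simp

theorem pderiv_sum {ι : Type*} {s : Finset ι} {f : ι → EuclideanSpace ℝ (Fin n) → ℝ}
    (hf : ∀ a ∈ s, DifferentiableAt ℝ (f a) y) (i : Fin n) :
    pderiv i (fun z => ∑ a ∈ s, f a z) y = ∑ a ∈ s, pderiv i (f a) y := by
  unfold pderiv
  rw [fderiv_fun_sum hf]
  simp

theorem pderiv_const (c : ℝ) (i : Fin n) : pderiv i (fun _ => c) y = 0 := by
  simp [pderiv]

/-- The entrywise partial derivative of a matrix-valued function. -/
def mderiv (i : Fin n) (F : EuclideanSpace ℝ (Fin n) → Matrix (Fin n) (Fin n) ℝ)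
    (y : EuclideanSpace ℝ (Fin n)) : Matrix (Fin n) (Fin n) ℝ :=
  Matrix.of fun a b => pderiv i (fun z => F z a b) y

/-- A matrix-valued function with smooth entries. -/
def MSmoothOn (F : EuclideanSpace ℝ (Fin n) → Matrix (Fin n) (Fin n) ℝ)
    (U : Set (EuclideanSpace ℝ (Fin n))) : Prop :=
  ∀ a b, ContDiffOn ℝ ∞ (fun z => F z a b) U

variable {F H : EuclideanSpace ℝ (Fin n) → Matrix (Fin n) (Fin n) ℝ}

theorem mderiv_congr (hU : IsOpen U) (hy : y ∈ U) (h : Set.EqOn F H U) (i : Fin n) :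
    mderiv i F y = mderiv i H y := by
  ext a b
  exact pderiv_congr hU hy (fun z hz => by simp only [h hz]) i

theorem MSmoothOn.congr (hF : MSmoothOn F U) (h : Set.EqOn H F U) : MSmoothOn H U :=
  fun a b => (hF a b).congr fun z hz => by simp only [h hz]

theorem MSmoothOn.differentiableAt (hF : MSmoothOn F U) (hU : IsOpen U) (hy : y ∈ U)
    (a b : Fin n) : DifferentiableAt ℝ (fun z => F z a b) y :=
  contDiffOn_differentiableAt hU hy (hF a b)

theorem MSmoothOn.mul (hF : MSmoothOn F U) (hH : MSmoothOn H U) :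
    MSmoothOn (fun z => F z * H z) U := by
  intro a b
  simp only [Matrix.mul_apply]
  exact ContDiffOn.sum fun c _ => (hF a c).mul (hH c b)

theorem MSmoothOn.add (hF : MSmoothOn F U) (hH : MSmoothOn H U) :
    MSmoothOn (fun z => F z + H z) U := fun a b => (hF a b).add (hH a b)

theorem MSmoothOn.sub (hF : MSmoothOn F U) (hH : MSmoothOn H U) :
    MSmoothOn (fun z => F z - H z) U := fun a b => (hF a b).sub (hH a b)

theorem MSmoothOn.transpose (hF : MSmoothOn F U) : MSmoothOn (fun z => (F z)ᵀ) U :=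
  fun a b => hF b a

theorem MSmoothOn.smul {f : EuclideanSpace ℝ (Fin n) → ℝ} (hf : ContDiffOn ℝ ∞ f U)
    (hF : MSmoothOn F U) : MSmoothOn (fun z => f z • F z) U :=
  fun a b => by simpa using hf.mul (hF a b)

theorem MSmoothOn.sum {ι : Type*} {s : Finset ι}
    {F : ι → EuclideanSpace ℝ (Fin n) → Matrix (Fin n) (Fin n) ℝ}
    (hF : ∀ c ∈ s, MSmoothOn (F c) U) : MSmoothOn (fun z => ∑ c ∈ s, F c z) U := by
  intro a b
  simp only [Matrix.sum_apply]
  exact ContDiffOn.sum fun c hc => hF c hc a b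

theorem MSmoothOn.mderiv (hF : MSmoothOn F U) (hU : IsOpen U) (i : Fin n) :
    MSmoothOn (mderiv i F) U := fun a b => contDiffOn_pderiv hU (hF a b) i

theorem MSmoothOn.trace (hF : MSmoothOn F U) : ContDiffOn ℝ ∞ (fun z => (F z).trace) U :=
  ContDiffOn.sum fun c _ => hF c c

theorem MSmoothOn.mono {V : Set (EuclideanSpace ℝ (Fin n))} (hF : MSmoothOn F U) (h : V ⊆ U) :
    MSmoothOn F V := fun a b => (hF a b).mono h

theorem MSmoothOn.det (hF : MSmoothOn F U) : ContDiffOn ℝ ∞ (fun z => (F z).det) U := by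
  simp only [Matrix.det_apply, zsmul_eq_mul, Units.smul_def]
  exact ContDiffOn.sum fun σ _ => contDiffOn_const.mul (contDiffOn_prod fun c _ => hF _ _)

/-- Cramer's rule: the entries are minors divided by the determinant. -/
theorem MSmoothOn.inv (hF : MSmoothOn F U) (hdet : ∀ z ∈ U, (F z).det ≠ 0) :
    MSmoothOn (fun z => (F z)⁻¹) U := by
  have hadj : MSmoothOn (fun z => (F z).adjugate) U := by
    intro a b
    simp only [Matrix.adjugate_apply]
    refine MSmoothOn.det fun c d => ?_
    by_cases hc : c = b
    · subst hc
      simpa using contDiffOn_const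
    · simpa [Matrix.updateRow_ne hc] using hF c d
  refine MSmoothOn.congr (MSmoothOn.smul (hF.det.inv hdet) hadj) fun z _ => ?_
  simp [Matrix.inv_def]

theorem mderiv_mul (hU : IsOpen U) (hy : y ∈ U) (hF : MSmoothOn F U) (hH : MSmoothOn H U)
    (i : Fin n) : mderiv i (fun z => F z * H z) y = mderiv i F y * H y + F y * mderiv i H y := by
  ext a b
  simp only [mderiv, Matrix.of_apply, Matrix.add_apply, Matrix.mul_apply]
  rw [pderiv_sum, ← Finset.sum_add_distrib]
  · exact Finset.sum_congr rfl fun c _ =>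
      pderiv_mul (hF.differentiableAt hU hy a c) (hH.differentiableAt hU hy c b) i
  · exact fun c _ => (hF.differentiableAt hU hy a c).mul (hH.differentiableAt hU hy c b)

theorem mderiv_add (hU : IsOpen U) (hy : y ∈ U) (hF : MSmoothOn F U) (hH : MSmoothOn H U)
    (i : Fin n) : mderiv i (fun z => F z + H z) y = mderiv i F y + mderiv i H y := by
  ext a b
  exact pderiv_add (hF.differentiableAt hU hy a b) (hH.differentiableAt hU hy a b) i

theorem mderiv_sub (hU : IsOpen U) (hy : y ∈ U) (hF : MSmoothOn F U) (hH : MSmoothOn H U)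
    (i : Fin n) : mderiv i (fun z => F z - H z) y = mderiv i F y - mderiv i H y := by
  ext a b
  exact pderiv_sub (hF.differentiableAt hU hy a b) (hH.differentiableAt hU hy a b) i

theorem mderiv_smul {f : EuclideanSpace ℝ (Fin n) → ℝ} (hU : IsOpen U) (hy : y ∈ U)
    (hf : ContDiffOn ℝ ∞ f U) (hF : MSmoothOn F U) (i : Fin n) :
    mderiv i (fun z => f z • F z) y = pderiv i f y • F y + f y • mderiv i F y := by
  ext a b
  exact pderiv_mul (contDiffOn_differentiableAt hU hy hf) (hF.differentiableAt hU hy a b) i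

theorem mderiv_sum {ι : Type*} {s : Finset ι}
    {F : ι → EuclideanSpace ℝ (Fin n) → Matrix (Fin n) (Fin n) ℝ} (hU : IsOpen U) (hy : y ∈ U)
    (hF : ∀ c ∈ s, MSmoothOn (F c) U) (i : Fin n) :
    mderiv i (fun z => ∑ c ∈ s, F c z) y = ∑ c ∈ s, mderiv i (F c) y := by
  ext a b
  simp only [mderiv, Matrix.of_apply, Matrix.sum_apply]
  exact pderiv_sum (fun c hc => (hF c hc).differentiableAt hU hy a b) i

theorem mderiv_transpose (i : Fin n) : mderiv i (fun z => (F z)ᵀ) y = (mderiv i F y)ᵀ := rfl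

theorem mderiv_comm (hU : IsOpen U) (hy : y ∈ U) (hF : MSmoothOn F U) (i j : Fin n) :
    mderiv i (mderiv j F) y = mderiv j (mderiv i F) y := by
  ext a b
  exact pderiv_comm hU hy (hF a b) i j

theorem mderiv_const (c : Matrix (Fin n) (Fin n) ℝ) (i : Fin n) :
    mderiv i (fun _ => c) y = 0 := by
  ext a b
  exact pderiv_const _ i

theorem pderiv_trace (hU : IsOpen U) (hy : y ∈ U) (hF : MSmoothOn F U) (i : Fin n) :
    pderiv i (fun z => (F z).trace) y = (mderiv i F y).trace :=
  pderiv_sum (fun c _ => hF.differentiableAt hU hy c c) i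

theorem mderiv_inv (hU : IsOpen U) (hy : y ∈ U) (hF : MSmoothOn F U)
    (hdet : ∀ z ∈ U, (F z).det ≠ 0) (i : Fin n) :
    mderiv i (fun z => (F z)⁻¹) y = -((F y)⁻¹ * mderiv i F y * (F y)⁻¹) := by
  have h1 : mderiv i (fun z => F z * (F z)⁻¹) y = 0 := by
    rw [mderiv_congr hU hy (H := fun _ => 1) fun z hz =>
      Matrix.mul_nonsing_inv _ (hdet z hz).isUnit, mderiv_const]
  rw [mderiv_mul hU hy hF (hF.inv hdet)] at h1
  have h2 := congrArg ((F y)⁻¹ * ·) h1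
  simp only [mul_add, mul_zero, ← mul_assoc,
    Matrix.nonsing_inv_mul _ (hdet y hy).isUnit, one_mul] at h2
  rw [eq_neg_iff_add_eq_zero, add_comm]
  exact h2

end MatrixCalculus

/-! ## The Levi-Civita connection in coordinates -/

section LeviCivita

variable {n : ℕ} {U : Set (EuclideanSpace ℝ (Fin n))} {y : EuclideanSpace ℝ (Fin n)}

/-- The connection matrices `(A_l)^m_i = Γ^m_{li}`. -/
def conn (G : EuclideanSpace ℝ (Fin n) → Matrix (Fin n) (Fin n) ℝ) (l : Fin n)
    (y : EuclideanSpace ℝ (Fin n)) : Matrix (Fin n) (Fin n) ℝ :=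
  Matrix.of fun m i => christoffel G m l i y

/-- The curvature matrices of the connection `d + A`. -/
def curv (A : Fin n → EuclideanSpace ℝ (Fin n) → Matrix (Fin n) (Fin n) ℝ) (i j : Fin n)
    (y : EuclideanSpace ℝ (Fin n)) : Matrix (Fin n) (Fin n) ℝ :=
  mderiv i (A j) y - mderiv j (A i) y + (A i y * A j y - A j y * A i y)

/-- The Ricci tensor as a matrix. -/
def ricMat (G : EuclideanSpace ℝ (Fin n) → Matrix (Fin n) (Fin n) ℝ)
    (y : EuclideanSpace ℝ (Fin n)) : Matrix (Fin n) (Fin n) ℝ :=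
  Matrix.of fun j k => ricci G j k y

/-- The Ricci tensor with its second index raised. -/
def ricUp (G : EuclideanSpace ℝ (Fin n) → Matrix (Fin n) (Fin n) ℝ)
    (y : EuclideanSpace ℝ (Fin n)) : Matrix (Fin n) (Fin n) ℝ :=
  ricMat G y * (G y)⁻¹

/-- `G` is a smooth Riemannian metric on the open set `U`. -/
structure IsMetricOn (G : EuclideanSpace ℝ (Fin n) → Matrix (Fin n) (Fin n) ℝ)
    (U : Set (EuclideanSpace ℝ (Fin n))) : Prop where
  isOpen : IsOpen U
  smooth : MSmoothOn G U
  posDef : ∀ z ∈ U, (G z).PosDef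

variable {G : EuclideanSpace ℝ (Fin n) → Matrix (Fin n) (Fin n) ℝ}
  {A : Fin n → EuclideanSpace ℝ (Fin n) → Matrix (Fin n) (Fin n) ℝ}

theorem IsMetricOn.symm (hG : IsMetricOn G U) (hy : y ∈ U) : (G y)ᵀ = G y := by
  simpa using (hG.posDef y hy).isHermitian.eq

theorem IsMetricOn.symm_apply (hG : IsMetricOn G U) (hy : y ∈ U) (a b : Fin n) :
    G y a b = G y b a := congrFun (congrFun (hG.symm hy) b) a

theorem IsMetricOn.det_ne (hG : IsMetricOn G U) (hy : y ∈ U) : (G y).det ≠ 0 :=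
  (hG.posDef y hy).det_pos.ne'

theorem IsMetricOn.inv_symm (hG : IsMetricOn G U) (hy : y ∈ U) : ((G y)⁻¹)ᵀ = (G y)⁻¹ := by
  rw [Matrix.transpose_nonsing_inv, hG.symm hy]

theorem IsMetricOn.inv_mul (hG : IsMetricOn G U) (hy : y ∈ U) : (G y)⁻¹ * G y = 1 :=
  Matrix.nonsing_inv_mul _ (hG.det_ne hy).isUnit

theorem IsMetricOn.mul_inv (hG : IsMetricOn G U) (hy : y ∈ U) : G y * (G y)⁻¹ = 1 :=
  Matrix.mul_nonsing_inv _ (hG.det_ne hy).isUnit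

theorem IsMetricOn.pderiv_symm (hG : IsMetricOn G U) (hy : y ∈ U) (i a b : Fin n) :
    pderiv i (fun z => G z a b) y = pderiv i (fun z => G z b a) y :=
  pderiv_congr hG.isOpen hy (fun _ hz => hG.symm_apply hz a b) i

theorem IsMetricOn.mono {V : Set (EuclideanSpace ℝ (Fin n))} (hG : IsMetricOn G U)
    (hV : IsOpen V) (h : V ⊆ U) : IsMetricOn G V :=
  ⟨hV, hG.smooth.mono h, fun z hz => hG.posDef z (h hz)⟩

/-- Lowering the upper index removes the inverse metric and leaves the Christoffel symbols of the
first kind, in which compatibility is a linear cancellation. -/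
theorem IsMetricOn.mul_conn_apply (hG : IsMetricOn G U) (hy : y ∈ U) (l a b : Fin n) :
    (G y * conn G l y) a b = 1 / 2 * (pderiv l (fun z => G z b a) y +
      pderiv b (fun z => G z l a) y - pderiv a (fun z => G z l b) y) := by
  have hc : conn G l y = (G y)⁻¹ * Matrix.of (fun a b => 1 / 2 * (pderiv l (fun z => G z b a) y +
      pderiv b (fun z => G z l a) y - pderiv a (fun z => G z l b) y)) := by
    ext m i
    simp only [conn, christoffel, Matrix.of_apply, Matrix.mul_apply, Finset.mul_sum]
    exact Finset.sum_congr rfl fun _ _ => by ring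
  rw [hc, ← mul_assoc, hG.mul_inv hy, one_mul]
  rfl

theorem IsMetricOn.conn_compat (hG : IsMetricOn G U) (hy : y ∈ U) (l : Fin n) :
    mderiv l G y = (conn G l y)ᵀ * G y + G y * conn G l y := by
  have h : (conn G l y)ᵀ * G y = (G y * conn G l y)ᵀ := by
    rw [Matrix.transpose_mul, hG.symm hy]
  ext a b
  rw [h, Matrix.add_apply, Matrix.transpose_apply, hG.mul_conn_apply hy, hG.mul_conn_apply hy,
    hG.pderiv_symm hy l b a]
  simp only [mderiv, Matrix.of_apply]
  ring

theorem IsMetricOn.conn_torsion (hG : IsMetricOn G U) (hy : y ∈ U) (l m i : Fin n) :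
    conn G l y m i = conn G i y m l := by
  simp only [conn, christoffel, Matrix.of_apply]
  congr 1
  refine Finset.sum_congr rfl fun k _ => ?_
  rw [hG.pderiv_symm hy k l i]
  ring

theorem IsMetricOn.smooth_inv (hG : IsMetricOn G U) : MSmoothOn (fun z => (G z)⁻¹) U :=
  hG.smooth.inv fun _ hz => hG.det_ne hz

theorem IsMetricOn.smooth_conn (hG : IsMetricOn G U) (l : Fin n) : MSmoothOn (conn G l) U := by
  intro m i
  simp only [conn, christoffel, Matrix.of_apply]
  refine contDiffOn_const.mul (ContDiffOn.sum fun k _ => (hG.smooth_inv m k).mul ?_)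
  exact ((contDiffOn_pderiv hG.isOpen (hG.smooth _ _) _).add
    (contDiffOn_pderiv hG.isOpen (hG.smooth _ _) _)).sub
    (contDiffOn_pderiv hG.isOpen (hG.smooth _ _) _)

/-- Applying the two transpositions alternately returns to the original index order after six steps,
with three changes of sign, so `C = -C`. This is the algebra behind uniqueness of the Levi-Civita
connection. -/
theorem eq_zero_of_skew_of_symm (C : Fin n → Matrix (Fin n) (Fin n) ℝ)
    (hskew : ∀ l a b, C l a b = -C l b a) (hsymm : ∀ l a b, C l a b = C b a l) (l a b : Fin n) :
    C l a b = 0 := by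
  linarith [hskew l a b, hsymm l b a, hskew a b l, hsymm a l b, hskew b l a, hsymm b a l]

/-- Uniqueness of the Levi-Civita connection. -/
theorem IsMetricOn.conn_unique (hG : IsMetricOn G U) (hy : y ∈ U)
    (B : Fin n → Matrix (Fin n) (Fin n) ℝ) (hB : ∀ l m i, B l m i = B i m l)
    (hcompat : ∀ l, mderiv l G y = (B l)ᵀ * G y + G y * B l) (l : Fin n) : conn G l y = B l := by
  have h0 : ∀ l, G y * (conn G l y - B l) = 0 := by
    intro l
    ext a b
    refine eq_zero_of_skew_of_symm (fun l => G y * (conn G l y - B l)) (fun l a b => ?_)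
      (fun l a b => ?_) l a b
    · have h := hcompat l
      rw [hG.conn_compat hy l] at h
      have h1 : (G y * (conn G l y - B l)) + (G y * (conn G l y - B l))ᵀ = 0 := by
        rw [Matrix.transpose_mul, hG.symm hy, Matrix.transpose_sub, mul_sub, sub_mul]
        rw [← sub_eq_zero] at h
        rw [← h]
        abel
      have h2 := congrFun (congrFun h1 a) b
      simp only [Matrix.add_apply, Matrix.transpose_apply, Matrix.zero_apply] at h2
      linarith
    · simp only [Matrix.mul_apply, Matrix.sub_apply]
      exact Finset.sum_congr rfl fun m _ => by rw [hG.conn_torsion hy l m b, hB l m b]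
  have h1 := congrArg ((G y)⁻¹ * ·) (h0 l)
  simp only [← mul_assoc, hG.inv_mul hy, one_mul, mul_zero] at h1
  exact sub_eq_zero.1 h1

/-! ### Curvature as the matrix-valued two-form `dA + A ∧ A`, and the Bianchi identities -/

theorem curvature_eq (l i j k : Fin n) :
    curvature G l i j k y = curv (conn G) i j y l k := by
  simp only [curvature, curv, Matrix.add_apply, Matrix.sub_apply, Matrix.mul_apply,
    Finset.sum_sub_distrib]
  rfl

theorem ricMat_apply (j k : Fin n) : ricMat G y j k = ∑ i, curv (conn G) i j y i k := by
  simp only [ricMat, ricci, Matrix.of_apply, curvature_eq]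

theorem curv_antisymm (i j : Fin n) : curv A i j y = -curv A j i y := by
  simp only [curv]; abel

theorem smooth_curv (hU : IsOpen U) (hA : ∀ l, MSmoothOn (A l) U) (i j : Fin n) :
    MSmoothOn (curv A i j) U :=
  (((hA j).mderiv hU i).sub ((hA i).mderiv hU j)).add
    (((hA i).mul (hA j)).sub ((hA j).mul (hA i)))

/-- The curvature annihilates parallel bilinear forms. -/
theorem curv_compat (hU : IsOpen U) (hA : ∀ l, MSmoothOn (A l) U)
    {S : EuclideanSpace ℝ (Fin n) → Matrix (Fin n) (Fin n) ℝ} (hS : MSmoothOn S U)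
    (h : ∀ z ∈ U, ∀ l, mderiv l S z = (A l z)ᵀ * S z + S z * A l z) (hy : y ∈ U) (k l : Fin n) :
    (curv A k l y)ᵀ * S y + S y * curv A k l y = 0 := by
  have key : ∀ k l, mderiv k (mderiv l S) y =
      ((mderiv k (A l) y)ᵀ * S y + (A l y)ᵀ * ((A k y)ᵀ * S y + S y * A k y)) +
      (((A k y)ᵀ * S y + S y * A k y) * A l y + S y * mderiv k (A l) y) := by
    intro k l
    rw [mderiv_congr hU hy (H := fun z => (A l z)ᵀ * S z + S z * A l z) fun z hz => h z hz l,
      mderiv_add hU hy ((hA l).transpose.mul hS) (hS.mul (hA l)),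
      mderiv_mul hU hy (hA l).transpose hS, mderiv_mul hU hy hS (hA l), mderiv_transpose,
      h y hy k]
  have hc := mderiv_comm hU hy hS k l
  rw [key, key, ← sub_eq_zero] at hc
  rw [← hc]
  simp only [curv, Matrix.transpose_add, Matrix.transpose_sub, Matrix.transpose_mul]
  noncomm_ring

/-- Without torsion, both `∂A` and `A A` are symmetric in the form index of the last factor and the
column index, so the six terms of each kind cancel in pairs in the cyclic sum. -/
theorem first_bianchi (hU : IsOpen U) (hy : y ∈ U)
    (hA : ∀ z ∈ U, ∀ l m i, A l z m i = A i z m l) (i j k l : Fin n) :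
    curv A i j y l k + curv A j k y l i + curv A k i y l j = 0 := by
  have hd : ∀ p a b c, mderiv p (A a) y b c = mderiv p (A c) y b a := fun p a b c =>
    pderiv_congr hU hy (fun z hz => hA z hz a b c) p
  have hm : ∀ a b c, (A a y * A b y) l c = (A a y * A c y) l b := fun a b c => by
    simp only [Matrix.mul_apply]
    exact Finset.sum_congr rfl fun m _ => by rw [hA y hy b m c]
  simp only [curv, Matrix.add_apply, Matrix.sub_apply]
  rw [hd i j l k, hd j k l i, hd k i l j, hm i j k, hm j k i, hm k i j]
  ring

/-- Second derivatives cancel because partial derivatives commute; what remains is a noncommutative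
polynomial identity. Only the matrix indices are differentiated covariantly, so torsion plays no
role and any connection is allowed. -/
theorem second_bianchi (hU : IsOpen U) (hy : y ∈ U) (hA : ∀ l, MSmoothOn (A l) U)
    (i j k : Fin n) :
    (mderiv k (curv A i j) y + A k y * curv A i j y - curv A i j y * A k y) +
    (mderiv i (curv A j k) y + A i y * curv A j k y - curv A j k y * A i y) +
    (mderiv j (curv A k i) y + A j y * curv A k i y - curv A k i y * A j y) = 0 := by
  have key : ∀ k i j, mderiv k (curv A i j) y =
      mderiv k (mderiv i (A j)) y - mderiv k (mderiv j (A i)) y +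
      ((mderiv k (A i) y * A j y + A i y * mderiv k (A j) y) -
        (mderiv k (A j) y * A i y + A j y * mderiv k (A i) y)) := by
    intro k i j
    unfold curv
    rw [mderiv_add hU hy (((hA j).mderiv hU i).sub ((hA i).mderiv hU j))
        (((hA i).mul (hA j)).sub ((hA j).mul (hA i))),
      mderiv_sub hU hy ((hA j).mderiv hU i) ((hA i).mderiv hU j),
      mderiv_sub hU hy ((hA i).mul (hA j)) ((hA j).mul (hA i)),
      mderiv_mul hU hy (hA i) (hA j), mderiv_mul hU hy (hA j) (hA i)]
  rw [key, key, key, mderiv_comm hU hy (hA j) k i, mderiv_comm hU hy (hA k) i j,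
    mderiv_comm hU hy (hA i) j k]
  simp only [curv]
  noncomm_ring

theorem IsMetricOn.curv_skew (hG : IsMetricOn G U) (hy : y ∈ U) (k l : Fin n) :
    (curv (conn G) k l y)ᵀ * G y + G y * curv (conn G) k l y = 0 :=
  curv_compat hG.isOpen hG.smooth_conn hG.smooth (fun _ hz l => hG.conn_compat hz l) hy k l

/-- An operator skew with respect to the metric is traceless. This is the term that obstructs
symmetry of the Ricci tensor in the contracted first Bianchi identity. -/
theorem IsMetricOn.curv_trace (hG : IsMetricOn G U) (hy : y ∈ U) (k l : Fin n) :
    (curv (conn G) k l y).trace = 0 := by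
  have h := congrArg (fun X => ((G y)⁻¹ * X).trace) (hG.curv_skew hy k l)
  simp only [mul_add, mul_zero, Matrix.trace_zero, Matrix.trace_add, ← mul_assoc,
    hG.inv_mul hy, one_mul] at h
  rw [Matrix.trace_mul_cycle, hG.mul_inv hy, one_mul, Matrix.trace_transpose] at h
  linarith

theorem IsMetricOn.ricMat_symm (hG : IsMetricOn G U) (hy : y ∈ U) :
    (ricMat G y)ᵀ = ricMat G y := by
  ext k j
  have hb : ∀ i, curv (conn G) i j y i k + curv (conn G) j k y i i - curv (conn G) i k y i j = 0 := by
    intro i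
    have h := first_bianchi hG.isOpen hy (fun z hz => hG.conn_torsion hz) i j k i
    rw [curv_antisymm k i, Matrix.neg_apply] at h
    linarith
  have ht := hG.curv_trace hy j k
  have hs := Finset.sum_congr rfl fun i (_ : i ∈ Finset.univ) => hb i
  rw [Finset.sum_sub_distrib, Finset.sum_add_distrib, Finset.sum_const_zero] at hs
  rw [Matrix.transpose_apply, ricMat_apply, ricMat_apply]
  rw [Matrix.trace] at ht
  simp only [Matrix.diag_apply] at ht
  linarith

theorem IsMetricOn.smooth_ricMat (hG : IsMetricOn G U) : MSmoothOn (ricMat G) U := by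
  intro j k
  simp only [ricMat_apply]
  exact ContDiffOn.sum fun i _ => smooth_curv hG.isOpen hG.smooth_conn i j i k

theorem IsMetricOn.smooth_ricUp (hG : IsMetricOn G U) : MSmoothOn (ricUp G) U :=
  hG.smooth_ricMat.mul hG.smooth_inv

theorem IsMetricOn.mderiv_inv_eq (hG : IsMetricOn G U) (hy : y ∈ U) (l : Fin n) :
    mderiv l (fun z => (G z)⁻¹) y = -(conn G l y * (G y)⁻¹ + (G y)⁻¹ * (conn G l y)ᵀ) := by
  rw [mderiv_inv hG.isOpen hy hG.smooth (fun _ hz => hG.det_ne hz), hG.conn_compat hy]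
  simp only [mul_add, add_mul, ← mul_assoc, hG.inv_mul hy, one_mul]
  simp only [mul_assoc, hG.mul_inv hy, mul_one]
  rw [add_comm]

end LeviCivita

/-! ## Recurrent Ricci tensors in coordinates -/

section Recurrent

variable {n : ℕ} {U : Set (EuclideanSpace ℝ (Fin n))} {y : EuclideanSpace ℝ (Fin n)}
  {G : EuclideanSpace ℝ (Fin n) → Matrix (Fin n) (Fin n) ℝ}

/-- The curvature matrices with the lower matrix index raised. -/
def curvUp (G : EuclideanSpace ℝ (Fin n) → Matrix (Fin n) (Fin n) ℝ) (i j : Fin n)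
    (y : EuclideanSpace ℝ (Fin n)) : Matrix (Fin n) (Fin n) ℝ :=
  curv (conn G) i j y * (G y)⁻¹

theorem curvUp_antisymm (i j : Fin n) : curvUp G i j y = -curvUp G j i y := by
  rw [curvUp, curv_antisymm, neg_mul, curvUp]

/-- Raising the index turns skewness relative to the metric into ordinary skewness of a matrix, the
form in which the Bianchi identity is easily contracted. -/
theorem IsMetricOn.curvUp_skew (hG : IsMetricOn G U) (hy : y ∈ U) (i j : Fin n) :
    (curvUp G i j y)ᵀ = -curvUp G i j y := by
  have h := congrArg (fun X => (G y)⁻¹ * X * (G y)⁻¹) (hG.curv_skew hy i j)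
  simp only [mul_add, add_mul, mul_zero, zero_mul] at h
  simp only [mul_assoc, hG.mul_inv hy, mul_one] at h
  simp only [← mul_assoc, hG.inv_mul hy, one_mul] at h
  rw [curvUp, Matrix.transpose_mul, hG.inv_symm hy]
  exact eq_neg_of_add_eq_zero_left h

theorem IsMetricOn.smooth_curvUp (hG : IsMetricOn G U) (i j : Fin n) :
    MSmoothOn (curvUp G i j) U :=
  (smooth_curv hG.isOpen hG.smooth_conn i j).mul hG.smooth_inv

theorem ricUp_apply (j b : Fin n) : ricUp G y j b = ∑ i, curvUp G i j y i b := by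
  simp only [ricUp, curvUp, Matrix.mul_apply, ricMat_apply, Finset.sum_mul]
  exact Finset.sum_comm

/-- The inverse metric is parallel, so raising an index commutes with covariant differentiation. -/
theorem IsMetricOn.mderiv_curvUp (hG : IsMetricOn G U) (hy : y ∈ U) (i j k : Fin n) :
    mderiv k (curvUp G i j) y + conn G k y * curvUp G i j y + curvUp G i j y * (conn G k y)ᵀ =
      (mderiv k (curv (conn G) i j) y + conn G k y * curv (conn G) i j y -
        curv (conn G) i j y * conn G k y) * (G y)⁻¹ := by
  have h : mderiv k (curvUp G i j) y = mderiv k (curv (conn G) i j) y * (G y)⁻¹ +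
      curv (conn G) i j y * mderiv k (fun z => (G z)⁻¹) y :=
    mderiv_mul hG.isOpen hy (smooth_curv hG.isOpen hG.smooth_conn i j) hG.smooth_inv k
  rw [h, hG.mderiv_inv_eq hy]
  simp only [curvUp]
  noncomm_ring

theorem IsMetricOn.curvUp_bianchi (hG : IsMetricOn G U) (hy : y ∈ U) (i j k : Fin n) :
    (mderiv k (curvUp G i j) y + conn G k y * curvUp G i j y + curvUp G i j y * (conn G k y)ᵀ) +
    (mderiv i (curvUp G j k) y + conn G i y * curvUp G j k y + curvUp G j k y * (conn G i y)ᵀ) +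
    (mderiv j (curvUp G k i) y + conn G j y * curvUp G k i y + curvUp G k i y * (conn G j y)ᵀ)
      = 0 := by
  rw [hG.mderiv_curvUp hy, hG.mderiv_curvUp hy, hG.mderiv_curvUp hy, ← add_mul, ← add_mul,
    second_bianchi hG.isOpen hy hG.smooth_conn, zero_mul]

/-- Contraction of a product of a form symmetric and an array antisymmetric in two indices. -/
theorem sum_symm_mul_skew (P Q : Fin n → Fin n → ℝ) (hP : ∀ i j, P i j = P j i)
    (hQ : ∀ i j, Q i j = -Q j i) : ∑ i, ∑ j, P i j * Q i j = 0 := by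
  have h : ∑ i, ∑ j, P i j * Q i j = -∑ i, ∑ j, P i j * Q i j := by
    conv_lhs => rw [Finset.sum_comm]
    simp only [← Finset.sum_neg_distrib]
    exact Finset.sum_congr rfl fun i _ => Finset.sum_congr rfl fun j _ => by
      rw [hP, hQ]; ring
  linarith

/-- The trace of the second Bianchi identity, for arrays of numbers. -/
theorem contracted_bianchi_aux (A : Fin n → Matrix (Fin n) (Fin n) ℝ)
    (hA : ∀ l m i, A l m i = A i m l) (W : Fin n → Fin n → Matrix (Fin n) (Fin n) ℝ)
    (hW : ∀ i j, W i j = -W j i) (hW' : ∀ i j a b, W i j a b = -W i j b a)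
    (D : Fin n → Fin n → Fin n → Matrix (Fin n) (Fin n) ℝ)
    (hD : ∀ k i j a b, D k i j a b = -D k j i a b) (hD' : ∀ k i j a b, D k i j a b = -D k i j b a)
    (hB : ∀ i j k, (D k i j + A k * W i j + W i j * (A k)ᵀ) +
      (D i j k + A i * W j k + W j k * (A i)ᵀ) +
      (D j k i + A j * W k i + W k i * (A j)ᵀ) = 0)
    (T : Matrix (Fin n) (Fin n) ℝ) (hT : ∀ j b, T j b = ∑ i, W i j i b)
    (dT : Fin n → Matrix (Fin n) (Fin n) ℝ) (hdT : ∀ k j b, dT k j b = ∑ i, D k i j i b)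
    (k : Fin n) :
    (dT k).trace + 2 * ∑ i, ∑ s, A k i s * T i s =
      2 * ∑ i, (dT i k i + ∑ s, T k s * A i i s) := by
  have hWa : ∀ i j a b, W i j a b = -W j i a b := fun i j a b => by rw [hW]; rfl
  -- Contract the row index with `i` and the column index with `j`. The nine sums `e1`, ..., `e9`
  -- are then traces of `T` and `dT`, except for `e6` and `e8`, which pair the symmetric Christoffel
  -- indices with skew ones and vanish.
  have h := Finset.sum_congr rfl fun i (_ : i ∈ Finset.univ) =>
    Finset.sum_congr rfl fun j (_ : j ∈ Finset.univ) => congrFun (congrFun (hB i j k) i) j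
  simp only [Matrix.add_apply, Finset.sum_add_distrib] at h
  rw [show ∑ i : Fin n, ∑ j : Fin n, (0 : Matrix (Fin n) (Fin n) ℝ) i j = 0 by simp] at h
  have e1 : ∑ i, ∑ j, D k i j i j = (dT k).trace := by
    simp only [Matrix.trace, Matrix.diag_apply, hdT]
    exact Finset.sum_comm
  have e2 : ∑ i, ∑ j, (A k * W i j) i j = ∑ i, ∑ s, A k i s * T i s := by
    simp only [Matrix.mul_apply, hT, Finset.mul_sum]
    refine Finset.sum_congr rfl fun i _ => ?_
    rw [Finset.sum_comm]
    exact Finset.sum_congr rfl fun s _ => Finset.sum_congr rfl fun j _ => by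
      rw [hWa, hW' j i s j]; ring
  have e3 : ∑ i, ∑ j, (W i j * (A k)ᵀ) i j = ∑ i, ∑ s, A k i s * T i s := by
    simp only [Matrix.mul_apply, hT, Finset.mul_sum, Matrix.transpose_apply]
    rw [Finset.sum_comm]
    refine Finset.sum_congr rfl fun i _ => ?_
    rw [Finset.sum_comm]
    exact Finset.sum_congr rfl fun s _ => Finset.sum_congr rfl fun j _ => by ring
  have e4 : ∑ i, ∑ j, D i j k i j = -∑ i, dT i k i := by
    simp only [hdT, ← Finset.sum_neg_distrib]
    exact Finset.sum_congr rfl fun i _ => Finset.sum_congr rfl fun j _ => hD' _ _ _ _ _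
  have e5 : ∑ i, ∑ j, (A i * W j k) i j = -∑ i, ∑ s, T k s * A i i s := by
    simp only [Matrix.mul_apply, hT, Finset.sum_mul, ← Finset.sum_neg_distrib]
    refine Finset.sum_congr rfl fun i _ => ?_
    rw [Finset.sum_comm]
    exact Finset.sum_congr rfl fun s _ => Finset.sum_congr rfl fun j _ => by
      rw [hW' j k s j]; ring
  have e6 : ∑ i, ∑ j, (W j k * (A i)ᵀ) i j = 0 := by
    rw [Finset.sum_comm]
    refine Finset.sum_eq_zero fun j _ => ?_
    simp only [Matrix.mul_apply, Matrix.transpose_apply]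
    rw [← sum_symm_mul_skew (fun i s => A i j s) (fun i s => W j k i s) (fun i s => hA _ _ _)
      fun i s => hW' _ _ _ _]
    exact Finset.sum_congr rfl fun s _ => Finset.sum_congr rfl fun j _ => by ring
  have e7 : ∑ i, ∑ j, D j k i i j = -∑ i, dT i k i := by
    rw [Finset.sum_comm]
    simp only [hdT, ← Finset.sum_neg_distrib]
    exact Finset.sum_congr rfl fun i _ => Finset.sum_congr rfl fun j _ => hD _ _ _ _ _
  have e8 : ∑ i, ∑ j, (A j * W k i) i j = 0 := by
    refine Finset.sum_eq_zero fun i _ => ?_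
    simp only [Matrix.mul_apply]
    rw [← sum_symm_mul_skew (fun j s => A j i s) (fun j s => W k i s j) (fun i s => hA _ _ _)
      fun i s => hW' _ _ _ _]
  have e9 : ∑ i, ∑ j, (W k i * (A j)ᵀ) i j = -∑ i, ∑ s, T k s * A i i s := by
    simp only [Matrix.mul_apply, hT, Finset.sum_mul, ← Finset.sum_neg_distrib,
      Matrix.transpose_apply]
    rw [Finset.sum_comm]
    refine Finset.sum_congr rfl fun i _ => ?_
    rw [Finset.sum_comm]
    exact Finset.sum_congr rfl fun s _ => Finset.sum_congr rfl fun j _ => by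
      rw [hWa k j]; ring
  rw [e1, e2, e3, e4, e5, e6, e7, e8, e9] at h
  rw [Finset.sum_add_distrib]
  linarith

/-- This is `d sc = 2 div Ri` for the mixed Ricci tensor; the Christoffel term of the divergence
belonging to its lower index has been moved to the left. -/
theorem IsMetricOn.contracted_bianchi (hG : IsMetricOn G U) (hy : y ∈ U) (k : Fin n) :
    (mderiv k (ricUp G) y).trace + 2 * ∑ i, ∑ s, conn G k y i s * ricUp G y i s =
      2 * ∑ i, (mderiv i (ricUp G) y k i + ∑ s, ricUp G y k s * conn G i y i s) := by
  have hs : ∀ z ∈ U, ∀ i j a b, curvUp G i j z a b = -curvUp G i j z b a := fun z hz i j a b =>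
    congrFun (congrFun (hG.curvUp_skew hz i j) b) a
  have hneg : ∀ (k : Fin n) (f h : EuclideanSpace ℝ (Fin n) → ℝ), (∀ z ∈ U, f z = -h z) →
      pderiv k f y = -pderiv k h y := by
    intro k f h hf
    rw [pderiv_congr hG.isOpen hy (h := fun z => -h z) hf]
    simp [pderiv, fderiv_fun_neg]
  refine contracted_bianchi_aux (fun l => conn G l y) (fun l m i => hG.conn_torsion hy l m i)
    (fun i j => curvUp G i j y) (fun i j => curvUp_antisymm i j) (hs y hy)
    (fun k i j => mderiv k (curvUp G i j) y) (fun k i j a b => ?_) (fun k i j a b => ?_)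
    (hG.curvUp_bianchi hy) _ ricUp_apply (fun k => mderiv k (ricUp G) y) (fun k j b => ?_) k
  · exact hneg k _ _ fun z _ => by rw [curvUp_antisymm]; rfl
  · exact hneg k _ _ fun z hz => hs z hz i j a b
  · simp only [mderiv, Matrix.of_apply, ricUp_apply]
    exact pderiv_sum (fun i _ => (hG.smooth_curvUp i j).differentiableAt hG.isOpen hy i b) k

/-- The Ricci tensor of `G` is recurrent on `U` with recurrence form `β`. -/
def RecurrentOn (G : EuclideanSpace ℝ (Fin n) → Matrix (Fin n) (Fin n) ℝ)
    (β : Fin n → EuclideanSpace ℝ (Fin n) → ℝ) (U : Set (EuclideanSpace ℝ (Fin n))) : Prop :=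
  ∀ z ∈ U, ∀ l, mderiv l (ricMat G) z =
    (conn G l z)ᵀ * ricMat G z + ricMat G z * conn G l z + β l z • ricMat G z

theorem recurrentOn_of_covDerivRicci {β : Fin n → EuclideanSpace ℝ (Fin n) → ℝ}
    (h : ∀ z ∈ U, ∀ i j l, covDerivRicci G i j l z = β l z * ricci G i j z) :
    RecurrentOn G β U := by
  intro z hz l
  ext i j
  have h1 := h z hz i j l
  simp only [covDerivRicci, Finset.sum_add_distrib] at h1
  simp only [mderiv, ricMat, conn, Matrix.of_apply, Matrix.add_apply, Matrix.mul_apply,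
    Matrix.transpose_apply, Matrix.smul_apply, smul_eq_mul]
  have h2 : ∑ x, ricci G i x z * christoffel G x l j z = ∑ x, christoffel G x l j z * ricci G i x z :=
    Finset.sum_congr rfl fun _ _ => mul_comm _ _
  change pderiv l (ricci G i j) z = _
  linarith

variable {β : Fin n → EuclideanSpace ℝ (Fin n) → ℝ}

/-- For the mixed tensor the connection enters through a commutator, which disappears in traces of
powers; only `β` survives there. -/
theorem RecurrentOn.mderiv_ricUp (hβ : RecurrentOn G β U) (hG : IsMetricOn G U) (hy : y ∈ U)
    (l : Fin n) : mderiv l (ricUp G) y =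
      (conn G l y)ᵀ * ricUp G y - ricUp G y * (conn G l y)ᵀ + β l y • ricUp G y := by
  have h : mderiv l (ricUp G) y = mderiv l (ricMat G) y * (G y)⁻¹ +
      ricMat G y * mderiv l (fun z => (G z)⁻¹) y :=
    mderiv_mul hG.isOpen hy hG.smooth_ricMat hG.smooth_inv l
  rw [h, hβ y hy, hG.mderiv_inv_eq hy]
  simp only [ricUp]
  noncomm_ring

/-- The recurrence form is an eigenvector of the Ricci operator to half the scalar curvature. -/
theorem RecurrentOn.eigen (hβ : RecurrentOn G β U) (hG : IsMetricOn G U) (hy : y ∈ U)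
    (k : Fin n) : β k y * (ricUp G y).trace = 2 * ∑ i, ricUp G y k i * β i y := by
  have h := hG.contracted_bianchi hy k
  have h1 : (mderiv k (ricUp G) y).trace = β k y * (ricUp G y).trace := by
    rw [hβ.mderiv_ricUp hG hy, Matrix.trace_add, Matrix.trace_sub, Matrix.trace_mul_comm,
      sub_self, zero_add, Matrix.trace_smul, smul_eq_mul]
  have h2 : ∀ i, mderiv i (ricUp G) y k i + ∑ s, ricUp G y k s * conn G i y i s =
      ∑ s, conn G k y s i * ricUp G y s i + ricUp G y k i * β i y := by
    intro i
    rw [hβ.mderiv_ricUp hG hy]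
    simp only [Matrix.add_apply, Matrix.sub_apply, Matrix.mul_apply, Matrix.transpose_apply,
      Matrix.smul_apply, smul_eq_mul]
    have h3 : ∑ s, conn G i y s k * ricUp G y s i = ∑ s, conn G k y s i * ricUp G y s i :=
      Finset.sum_congr rfl fun s _ => by rw [hG.conn_torsion hy]
    rw [h3]
    ring
  rw [h1, Finset.sum_congr rfl fun i _ => h2 i, Finset.sum_add_distrib,
    Finset.sum_comm (f := fun i s => conn G k y s i * ricUp G y s i)] at h
  linarith

theorem RecurrentOn.pderiv_trace_ricUp (hβ : RecurrentOn G β U) (hG : IsMetricOn G U)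
    (hy : y ∈ U) (l : Fin n) :
    pderiv l (fun z => (ricUp G z).trace) y = β l y * (ricUp G y).trace := by
  rw [pderiv_trace hG.isOpen hy hG.smooth_ricUp, hβ.mderiv_ricUp hG hy, Matrix.trace_add,
    Matrix.trace_sub, Matrix.trace_mul_comm, sub_self, zero_add, Matrix.trace_smul, smul_eq_mul]

/-- The squared norm of the Ricci tensor. -/
def ricNormSq (G : EuclideanSpace ℝ (Fin n) → Matrix (Fin n) (Fin n) ℝ)
    (y : EuclideanSpace ℝ (Fin n)) : ℝ :=
  (ricUp G y * ricUp G y).trace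

theorem IsMetricOn.smooth_ricNormSq (hG : IsMetricOn G U) : ContDiffOn ℝ ∞ (ricNormSq G) U :=
  (hG.smooth_ricUp.mul hG.smooth_ricUp).trace

/-- The commutator with the connection has trace zero against powers of the mixed tensor. The
resulting equation is linear and homogeneous, which is what propagates nonvanishing. -/
theorem RecurrentOn.pderiv_ricNormSq (hβ : RecurrentOn G β U) (hG : IsMetricOn G U)
    (hy : y ∈ U) (l : Fin n) :
    pderiv l (ricNormSq G) y = 2 * β l y * ricNormSq G y := by
  have h : pderiv l (ricNormSq G) y = (mderiv l (fun z => ricUp G z * ricUp G z) y).trace :=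
    pderiv_trace hG.isOpen hy (hG.smooth_ricUp.mul hG.smooth_ricUp) l
  rw [h, mderiv_mul hG.isOpen hy hG.smooth_ricUp hG.smooth_ricUp, hβ.mderiv_ricUp hG hy]
  set T := ricUp G y
  set B := (conn G l y)ᵀ
  have e : (B * T - T * B + β l y • T) * T + T * (B * T - T * B + β l y • T) =
      B * (T * T) - (T * T) * B + (2 * β l y) • (T * T) := by
    simp only [add_mul, mul_add, sub_mul, mul_sub, two_mul, add_smul, smul_mul_assoc,
      mul_smul_comm, mul_assoc]
    abel
  rw [e, Matrix.trace_add, Matrix.trace_sub, Matrix.trace_mul_comm, sub_self, zero_add,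
    Matrix.trace_smul, smul_eq_mul]
  rfl

theorem IsMetricOn.scalar_eq_trace (hG : IsMetricOn G U) (hy : y ∈ U) :
    scalar G y = (ricUp G y).trace := by
  simp only [scalar, ricUp, Matrix.trace, Matrix.diag_apply, Matrix.mul_apply]
  refine Finset.sum_congr rfl fun i _ => Finset.sum_congr rfl fun j _ => ?_
  rw [mul_comm, show (G y)⁻¹ i j = (G y)⁻¹ j i from congrFun (congrFun (hG.inv_symm hy) j) i]
  rfl

/-- At points where the Ricci tensor does not vanish, it is annihilated by the curvature. -/
theorem RecurrentOn.curv_ricMat (hβ : RecurrentOn G β U) (hG : IsMetricOn G U) (hy : y ∈ U)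
    (hpos : ∀ z ∈ U, 0 < ricNormSq G z) (k l : Fin n) :
    (curv (conn G) k l y)ᵀ * ricMat G y + ricMat G y * curv (conn G) k l y = 0 := by
  -- With `f = 1/|Ri|` one has `df = -β f`, so `f Ri` is parallel and `curv_compat` applies to it.
  set f : EuclideanSpace ℝ (Fin n) → ℝ := fun z => (√(ricNormSq G z))⁻¹ with hf
  have hs : ∀ z ∈ U, √(ricNormSq G z) ≠ 0 := fun z hz => (Real.sqrt_pos.2 (hpos z hz)).ne'
  have hfs : ContDiffOn ℝ ∞ f U := (hG.smooth_ricNormSq.sqrt fun z hz => (hpos z hz).ne').inv hs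
  have hfd : ∀ z ∈ U, ∀ l, pderiv l f z = -β l z * f z := by
    intro z hz l
    -- Differentiating `f² |Ri|² = 1` avoids differentiating the square root.
    have h1 : pderiv l (fun z => (f z * f z) * ricNormSq G z) z = 0 := by
      rw [pderiv_congr hG.isOpen hz (h := fun _ => 1), pderiv_const]
      intro w hw
      simp only [hf]
      rw [← mul_inv, Real.mul_self_sqrt (hpos w hw).le, inv_mul_cancel₀ (hpos w hw).ne']
    have hfz := contDiffOn_differentiableAt hG.isOpen hz hfs
    rw [pderiv_mul (hfz.fun_mul hfz) (contDiffOn_differentiableAt hG.isOpen hz hG.smooth_ricNormSq),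
      pderiv_mul hfz hfz, hβ.pderiv_ricNormSq hG hz] at h1
    have h2 : (2 * f z * ricNormSq G z) * (pderiv l f z + β l z * f z) = 0 := by
      linear_combination h1
    have h3 : f z ≠ 0 := inv_ne_zero (hs z hz)
    have h4 := (mul_eq_zero.1 h2).resolve_left
      (mul_ne_zero (mul_ne_zero two_ne_zero h3) (hpos z hz).ne')
    linarith
  have h := curv_compat hG.isOpen hG.smooth_conn (S := fun z => f z • ricMat G z)
    (MSmoothOn.smul hfs hG.smooth_ricMat) (fun z hz l => ?_) hy k l
  · simp only [mul_smul_comm, smul_mul_assoc, ← smul_add] at h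
    exact (smul_eq_zero.1 h).resolve_left (inv_ne_zero (hs y hy))
  · rw [mderiv_smul hG.isOpen hz hfs hG.smooth_ricMat, hfd z hz, hβ z hz]
    simp only [smul_add, mul_smul_comm, smul_mul_assoc, smul_smul]
    module

end Recurrent

/-! ## Pointwise algebra of curvature tensors -/

section Algebra

variable {n : ℕ}

theorem exists_orthogonal_diagonal {A : Matrix (Fin n) (Fin n) ℝ} (hA : A.IsHermitian) :
    ∃ U : Matrix (Fin n) (Fin n) ℝ, Uᵀ * U = 1 ∧ Uᵀ * A * U = Matrix.diagonal hA.eigenvalues := by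
  refine ⟨hA.eigenvectorUnitary, ?_, ?_⟩
  · exact Unitary.coe_star_mul_self hA.eigenvectorUnitary
  · have h := hA.conjStarAlgAut_star_eigenvectorUnitary
    rw [Unitary.conjStarAlgAut_star_apply] at h
    exact h

/-- Simultaneous diagonalization of a positive definite and a symmetric matrix. -/
theorem exists_frame {G S : Matrix (Fin n) (Fin n) ℝ} (hG : G.PosDef) (hS : Sᵀ = S) :
    ∃ (M : Matrix (Fin n) (Fin n) ℝ) (d : Fin n → ℝ),
      Mᵀ * G * M = 1 ∧ Mᵀ * S * M = Matrix.diagonal d := by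
  obtain ⟨V, -, hV⟩ := exists_orthogonal_diagonal hG.isHermitian
  set e := hG.isHermitian.eigenvalues
  -- `Q` is an orthonormal frame for `G`. An orthogonal change of frame `W` preserves this and
  -- diagonalizes `S` as well.
  set Q := V * Matrix.diagonal fun i => (√(e i))⁻¹ with hQ
  have hQG : Qᵀ * G * Q = 1 := by
    calc Qᵀ * G * Q = Matrix.diagonal (fun i => (√(e i))⁻¹) * (Vᵀ * G * V) *
          Matrix.diagonal (fun i => (√(e i))⁻¹) := by
          rw [hQ, Matrix.transpose_mul, Matrix.diagonal_transpose]
          simp only [mul_assoc]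
      _ = 1 := by
          rw [hV, Matrix.diagonal_mul_diagonal, Matrix.diagonal_mul_diagonal, ← Matrix.diagonal_one]
          congr 1
          funext i
          have hi := hG.eigenvalues_pos i
          have h1 : √(e i) ≠ 0 := (Real.sqrt_pos.2 hi).ne'
          have h2 : √(e i) * √(e i) = e i := Real.mul_self_sqrt hi.le
          field_simp
          rw [sq, h2]
  clear_value Q
  have hH : (Qᵀ * S * Q).IsHermitian := by
    rw [Matrix.IsHermitian, Matrix.conjTranspose_eq_transpose_of_trivial]
    simp only [Matrix.transpose_mul, hS, Matrix.transpose_transpose, mul_assoc]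
  obtain ⟨W, hW1, hW⟩ := exists_orthogonal_diagonal hH
  refine ⟨Q * W, hH.eigenvalues, ?_, ?_⟩
  · calc (Q * W)ᵀ * G * (Q * W) = Wᵀ * (Qᵀ * G * Q) * W := by
          rw [Matrix.transpose_mul]; simp only [mul_assoc]
      _ = 1 := by rw [hQG, mul_one, hW1]
  · rw [← hW, Matrix.transpose_mul]
    simp only [mul_assoc]

section Frame

variable {G S M : Matrix (Fin n) (Fin n) ℝ} {d : Fin n → ℝ}

/-- The columns of `M` are an orthonormal frame, so `G⁻¹ = M Mᵀ`, and the mixed tensor has the same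
traces of powers as the diagonal matrix. -/
theorem trace_frame (hM : Mᵀ * G * M = 1) (hd : Mᵀ * S * M = Matrix.diagonal d) :
    (S * G⁻¹).trace = ∑ i, d i ∧ (S * G⁻¹ * (S * G⁻¹)).trace = ∑ i, d i ^ 2 := by
  have hN : M * (Mᵀ * G) = 1 := mul_eq_one_comm.1 hM
  have hGi : G⁻¹ = M * Mᵀ := Matrix.inv_eq_left_inv (by rw [mul_assoc, hN])
  constructor
  · rw [hGi, ← mul_assoc, Matrix.trace_mul_comm, ← mul_assoc, hd, Matrix.trace_diagonal]
  · have h : (S * G⁻¹ * (S * G⁻¹)).trace = (Mᵀ * S * M * (Mᵀ * S * M)).trace := by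
      rw [hGi, ← mul_assoc, ← mul_assoc, Matrix.trace_mul_comm]
      simp only [mul_assoc]
    rw [h, hd, Matrix.diagonal_mul_diagonal, Matrix.trace_diagonal]
    exact Finset.sum_congr rfl fun i _ => by ring

/-- The rows of `M⁻¹` are the coframe dual to the columns of `M`. -/
theorem eq_of_frame (hM : Mᵀ * G * M = 1) (hd : Mᵀ * S * M = Matrix.diagonal d) :
    (∀ i j, G i j = ∑ a, M⁻¹ a i * M⁻¹ a j) ∧ ∀ i j, S i j = ∑ a, d a * (M⁻¹ a i * M⁻¹ a j) := by
  have hN : M * (Mᵀ * G) = 1 := mul_eq_one_comm.1 hM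
  have hdet : IsUnit M.det := Matrix.isUnit_det_of_right_inverse hN
  have key : ∀ X : Matrix (Fin n) (Fin n) ℝ, X = (M⁻¹)ᵀ * (Mᵀ * X * M) * M⁻¹ := by
    intro X
    have h1 : (M⁻¹)ᵀ * Mᵀ = 1 := by
      rw [← Matrix.transpose_mul, Matrix.mul_nonsing_inv _ hdet, Matrix.transpose_one]
    calc X = ((M⁻¹)ᵀ * Mᵀ) * X * (M * M⁻¹) := by rw [h1, Matrix.mul_nonsing_inv _ hdet]; simp
      _ = _ := by simp only [mul_assoc]
  constructor
  · intro i j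
    rw [key G, hM, mul_one]
    simp [Matrix.mul_apply]
  · intro i j
    rw [key S, hd, Matrix.mul_apply]
    simp only [Matrix.mul_diagonal, Matrix.transpose_apply]
    exact Finset.sum_congr rfl fun a _ => by ring

end Frame

theorem trace_sq_nonneg {G S : Matrix (Fin n) (Fin n) ℝ} (hG : G.PosDef) (hS : Sᵀ = S) :
    0 ≤ (S * G⁻¹ * (S * G⁻¹)).trace := by
  obtain ⟨M, d, hM, hd⟩ := exists_frame hG hS
  rw [(trace_frame hM hd).2]
  positivity

/-- The trace is the sum of squares of the eigenvalues relative to `G`. Positivity of the metric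
enters here: the scalar `|Ri|²` detects the zeros of the tensor. -/
theorem eq_zero_of_trace_sq {G S : Matrix (Fin n) (Fin n) ℝ} (hG : G.PosDef) (hS : Sᵀ = S)
    (h : (S * G⁻¹ * (S * G⁻¹)).trace = 0) : S = 0 := by
  obtain ⟨M, d, hM, hd⟩ := exists_frame hG hS
  rw [(trace_frame hM hd).2] at h
  have h0 := (Finset.sum_eq_zero_iff_of_nonneg fun i _ => sq_nonneg (d i)).1 h
  ext i j
  rw [(eq_of_frame hM hd).2]
  exact Finset.sum_eq_zero fun a _ => by
    rw [pow_eq_zero_iff two_ne_zero |>.1 (h0 a (Finset.mem_univ a)), zero_mul]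

/-- Contraction of a tensor of curvature type after a change of frame. -/
theorem contract_conj {R : Fin n → Fin n → Matrix (Fin n) (Fin n) ℝ}
    {S J N : Matrix (Fin n) (Fin n) ℝ} (hS : ∀ j k, S j k = ∑ i, R i j i k) (hJ : J * N = 1)
    (b c : Fin n) :
    ∑ a, (∑ i, ∑ j, (J i a * J j b) • (N * R i j * J)) a c = (Jᵀ * S * J) b c := by
  have h1 : ∀ i j, ∑ a, J i a * (N * R i j * J) a c = (R i j * J) i c := by
    intro i j
    have h : J * (N * R i j * J) = R i j * J := by simp only [← mul_assoc, hJ, one_mul]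
    rw [← h, Matrix.mul_apply]
  calc ∑ a, (∑ i, ∑ j, (J i a * J j b) • (N * R i j * J)) a c
      = ∑ i, ∑ j, J j b * ∑ a, J i a * (N * R i j * J) a c := by
        simp only [Matrix.sum_apply, Matrix.smul_apply, smul_eq_mul, Finset.mul_sum]
        rw [Finset.sum_comm]
        refine Finset.sum_congr rfl fun i _ => ?_
        rw [Finset.sum_comm]
        exact Finset.sum_congr rfl fun j _ => Finset.sum_congr rfl fun a _ => by ring
    _ = (Jᵀ * S * J) b c := by
        simp only [h1]
        rw [mul_assoc, Matrix.mul_apply, Finset.sum_comm]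
        refine Finset.sum_congr rfl fun j _ => ?_
        rw [Matrix.transpose_apply, ← Finset.mul_sum]
        congr 1
        simp only [Matrix.mul_apply, hS, Finset.sum_mul]
        exact Finset.sum_comm

variable {G S : Matrix (Fin n) (Fin n) ℝ} {R : Fin n → Fin n → Matrix (Fin n) (Fin n) ℝ}

/-- In a frame that diagonalizes the Ricci tensor, the curvature satisfies
`K_{ab} (λ_a - λ_b) = 0` if it annihilates the Ricci tensor. -/
theorem exists_sectional (hG : G.PosDef) (hS : Sᵀ = S) (hR : ∀ i j, R i j = -R j i)
    (hRG : ∀ i j, (R i j)ᵀ * G + G * R i j = 0) (hRS : ∀ i j, (R i j)ᵀ * S + S * R i j = 0)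
    (hSR : ∀ j k, S j k = ∑ i, R i j i k) :
    ∃ (M : Matrix (Fin n) (Fin n) ℝ) (d : Fin n → ℝ) (K : Fin n → Fin n → ℝ),
      Mᵀ * G * M = 1 ∧ Mᵀ * S * M = Matrix.diagonal d ∧ (∀ a b, K a b = K b a) ∧
      (∀ a, K a a = 0) ∧ (∀ a b, K a b * (d a - d b) = 0) ∧ ∀ b, d b = ∑ a, K a b := by
  obtain ⟨M, d, hM, hd⟩ := exists_frame hG hS
  have hN : M * (Mᵀ * G) = 1 := mul_eq_one_comm.1 hM
  -- The curvature operator `R(e_a, e_b)` written in the frame `e` of columns of `M`, where `Mᵀ G`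
  -- is the inverse of `M`. Its `(a, b)` entry is the sectional curvature of the plane of `e_a` and
  -- `e_b`.
  set Q : Fin n → Fin n → Matrix (Fin n) (Fin n) ℝ :=
    fun a b => ∑ i, ∑ j, (M i a * M j b) • ((Mᵀ * G) * R i j * M) with hQ
  have hQa : ∀ a b, Q a b = -Q b a := by
    intro a b
    simp only [hQ]
    rw [Finset.sum_comm]
    simp only [← Finset.sum_neg_distrib]
    refine Finset.sum_congr rfl fun j _ => Finset.sum_congr rfl fun i _ => ?_
    rw [hR i j, mul_comm (M i a), mul_neg, neg_mul, smul_neg]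
  have hQs : ∀ a b, (Q a b)ᵀ = -Q a b := by
    intro a b
    simp only [hQ, Matrix.transpose_sum, ← Finset.sum_neg_distrib]
    refine Finset.sum_congr rfl fun i _ => Finset.sum_congr rfl fun j _ => ?_
    rw [Matrix.transpose_smul, ← smul_neg]
    congr 1
    have hGt : Gᵀ = G := by simpa using hG.isHermitian.eq
    rw [eq_neg_iff_add_eq_zero]
    calc (Mᵀ * G * R i j * M)ᵀ + Mᵀ * G * R i j * M
        = Mᵀ * ((R i j)ᵀ * G + G * R i j) * M := by
          simp only [Matrix.transpose_mul, Matrix.transpose_transpose, hGt, mul_add, add_mul,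
            mul_assoc]
      _ = 0 := by rw [hRG]; simp
  have hQd : ∀ a b, (Q a b)ᵀ * Matrix.diagonal d + Matrix.diagonal d * Q a b = 0 := by
    intro a b
    simp only [hQ, Matrix.transpose_sum, Finset.sum_mul, Finset.mul_sum,
      ← Finset.sum_add_distrib]
    refine Finset.sum_eq_zero fun i _ => Finset.sum_eq_zero fun j _ => ?_
    rw [Matrix.transpose_smul, smul_mul_assoc, mul_smul_comm, ← smul_add]
    have h1 : Matrix.diagonal d * (Mᵀ * G * R i j * M) = Mᵀ * (S * R i j) * M := by
      rw [← hd]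
      calc Mᵀ * S * M * (Mᵀ * G * R i j * M) = Mᵀ * S * (M * (Mᵀ * G)) * R i j * M := by
            simp only [mul_assoc]
        _ = _ := by rw [hN]; simp only [mul_assoc, mul_one]
    have h2 : (Mᵀ * G * R i j * M)ᵀ * Matrix.diagonal d = Mᵀ * ((R i j)ᵀ * S) * M := by
      have := congrArg Matrix.transpose h1
      simpa only [Matrix.transpose_mul, Matrix.diagonal_transpose, Matrix.transpose_transpose, hS,
        mul_assoc] using this
    rw [h1, h2, ← add_mul, ← mul_add, hRS]
    simp
  refine ⟨M, d, fun a b => Q a b a b, hM, hd, fun a b => ?_, fun a => ?_, fun a b => ?_,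
    fun b => ?_⟩
  · have h1 := congrFun (congrFun (hQs b a) a) b
    have h2 := congrFun (congrFun (hQa a b) a) b
    simp only [Matrix.transpose_apply, Matrix.neg_apply] at h1 h2
    linarith
  · have h2 := congrFun (congrFun (hQa a a) a) a
    simp only [Matrix.neg_apply] at h2
    linarith
  -- The `(a, b)` entry of the annihilation identity, with `Q_ba = -Q_ab`.
  · have h1 := congrFun (congrFun (hQs a b) a) b
    have h2 := congrFun (congrFun (hQd a b) a) b
    simp only [Matrix.transpose_apply, Matrix.neg_apply, Matrix.add_apply, Matrix.mul_diagonal,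
      Matrix.diagonal_mul, Matrix.zero_apply] at h1 h2
    rw [h1] at h2
    linarith
  · have h := contract_conj hSR hN b b
    rw [hd, Matrix.diagonal_apply_eq] at h
    exact h.symm

/-- The shape of a non-Einstein Ricci tensor annihilated by the curvature in dimension three. -/
theorem ricci_dim_three {G S : Matrix (Fin 3) (Fin 3) ℝ}
    {R : Fin 3 → Fin 3 → Matrix (Fin 3) (Fin 3) ℝ}
    (hG : G.PosDef) (hS : Sᵀ = S) (hR : ∀ i j, R i j = -R j i)
    (hRG : ∀ i j, (R i j)ᵀ * G + G * R i j = 0) (hRS : ∀ i j, (R i j)ᵀ * S + S * R i j = 0)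
    (hSR : ∀ j k, S j k = ∑ i, R i j i k)
    (hne : 3 * (S * G⁻¹ * (S * G⁻¹)).trace - (S * G⁻¹).trace ^ 2 ≠ 0) :
    (S * G⁻¹).trace ≠ 0 ∧ ∃ w : Fin 3 → ℝ, ∀ i j,
      S i j = (S * G⁻¹).trace / 2 * (G i j - w i * w j) := by
  obtain ⟨M, d, K, hM, hd, hK, hK0, hKd, hdK⟩ := exists_sectional hG hS hR hRG hRS hSR
  obtain ⟨t1, t2⟩ := trace_frame hM hd
  obtain ⟨e1, e2⟩ := eq_of_frame hM hd
  rw [t1, t2] at hne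
  -- It suffices that the spectrum be `(σ/2, σ/2, 0)` up to order; `w` is then the dual covector of
  -- the null direction `c`.
  suffices h : (∑ i, d i) ≠ 0 ∧ ∃ c, ∀ a, d a = (∑ i, d i) / 2 * (1 - if a = c then 1 else 0) by
    obtain ⟨h0, c, hc⟩ := h
    rw [t1]
    refine ⟨h0, fun i => M⁻¹ c i, fun i j => ?_⟩
    rw [e1, e2]
    generalize (∑ i, d i) = σ at hc
    simp [hc, mul_sub, sub_mul, Finset.sum_sub_distrib, Finset.mul_sum]
  have d0 := hdK 0
  have d1 := hdK 1
  have d2 := hdK 2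
  simp only [Fin.sum_univ_three, hK0, hK 1 0, hK 2 0, hK 2 1] at d0 d1 d2 hne ⊢
  have k1 := hKd 0 1
  have k2 := hKd 0 2
  have k3 := hKd 1 2
  generalize K 0 1 = x at *
  generalize K 0 2 = z at *
  generalize K 1 2 = v at *
  rw [d0, d1] at k1
  rw [d0, d2] at k2
  rw [d1, d2] at k3
  rw [d0, d1, d2] at hne ⊢
  -- The eigenvalues are `x + z`, `x + v`, `z + v`, subject to `x (z - v) = z (x - v) = v (x - z) =
  -- 0`. Either `x = z = v`, excluded by `hne`, or exactly one of the three is nonzero.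
  by_cases hx : x = 0
  · subst hx
    by_cases hz : z = 0
    · subst hz
      have hv : v ≠ 0 := by
        rintro rfl
        exact hne (by ring)
      refine ⟨by intro h; apply hv; linarith, 0, fun a => ?_⟩
      fin_cases a <;> simp [d0, d1, d2]
    · have hv : v = 0 := by
        have := (mul_eq_zero.1 k2).resolve_left hz
        linarith
      subst hv
      refine ⟨by intro h; apply hz; linarith, 1, fun a => ?_⟩
      fin_cases a <;> simp [d0, d1, d2]
  · have hzv := (mul_eq_zero.1 k1).resolve_left hx
    have hz : z = 0 := by
      by_contra hz
      have := (mul_eq_zero.1 k2).resolve_left hz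
      have h1 : z = v := by linarith
      have h2 : x = v := by linarith
      subst h1 h2
      exact hne (by ring)
    have hv : v = 0 := by linarith
    subst hz hv
    refine ⟨by intro h; apply hx; linarith, 2, fun a => ?_⟩
    fin_cases a <;> simp [d0, d1, d2]

/-- In dimension greater than three, a quasi Einstein Ricci tensor that is annihilated by
the curvature and has an eigencovector to half the scalar curvature is zero. -/
theorem ricci_eq_zero_of_quasiEinstein (hn : 3 < n) (hG : G.PosDef)
    (hRG : ∀ i j, (R i j)ᵀ * G + G * R i j = 0) (hRS : ∀ i j, (R i j)ᵀ * S + S * R i j = 0)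
    (hSR : ∀ j k, S j k = ∑ i, R i j i k) {β : Fin n → ℝ} (hβ : β ≠ 0)
    (heig : (S * G⁻¹).trace • β = (2 : ℝ) • ((S * G⁻¹) *ᵥ β)) {a b : ℝ} {η : Fin n → ℝ}
    (hq : S = a • G + b • Matrix.vecMulVec η η) : S = 0 := by
  have hn' : (3 : ℝ) < n := by exact_mod_cast hn
  have hdet : IsUnit G.det := hG.det_pos.ne'.isUnit
  have hGi : G * G⁻¹ = 1 := Matrix.mul_nonsing_inv _ hdet
  have hGt : Gᵀ = G := by simpa using hG.isHermitian.eq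
  -- In the Einstein case `sc = n a`, and the eigenvector equation becomes `(n - 2) a β = 0`.
  by_cases hb : b • Matrix.vecMulVec η η = 0
  · rw [hb, add_zero] at hq
    rw [hq, smul_mul_assoc, hGi, Matrix.trace_smul, Matrix.trace_one, Matrix.smul_mulVec,
      Matrix.one_mulVec, smul_smul] at heig
    have h1 : ((n : ℝ) - 2) * a = 0 := by
      have h2 : (((n : ℝ) - 2) * a) • β = 0 := by
        rw [← sub_eq_zero, ← sub_smul] at heig
        convert heig using 2
        simp; ring
      exact (smul_eq_zero.1 h2).resolve_right hβ
    have ha : a = 0 := (mul_eq_zero.1 h1).resolve_left (by linarith)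
    rw [hq, ha, zero_smul]
  exfalso
  have hb0 : b ≠ 0 := fun h => hb (by rw [h, zero_smul])
  have hη : η ≠ 0 := fun h => hb (by rw [h]; ext; simp)
  -- The curvature annihilates `S` and `G`, hence `η ⊗ η`. With `τ` the image of `η` this reads `τ ⊗
  -- η + η ⊗ τ = 0`, which forces `τ = 0` since `η ≠ 0`.
  have hτ : ∀ i j, (R i j)ᵀ *ᵥ η = 0 := by
    intro i j
    have h1 := hRS i j
    rw [hq] at h1
    have h2 : b • (Matrix.vecMulVec ((R i j)ᵀ *ᵥ η) η + Matrix.vecMulVec η ((R i j)ᵀ *ᵥ η)) = 0 := by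
      calc _ = (R i j)ᵀ * (a • G + b • Matrix.vecMulVec η η) +
            (a • G + b • Matrix.vecMulVec η η) * R i j -
            a • ((R i j)ᵀ * G + G * R i j) := by
            rw [Matrix.mulVec_transpose]
            simp only [mul_add, add_mul, mul_smul_comm, smul_mul_assoc, Matrix.mul_vecMulVec,
              Matrix.vecMulVec_mul, Matrix.mulVec_transpose, smul_add]
            abel
        _ = 0 := by rw [h1, hRG]; simp
    have h3 := (smul_eq_zero.1 h2).resolve_left hb0
    set τ := (R i j)ᵀ *ᵥ η
    obtain ⟨l, hl⟩ := Function.ne_iff.1 hη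
    have h4 : ∀ k, τ k * η l + η k * τ l = 0 := fun k => by
      simpa [Matrix.vecMulVec_apply] using congrFun (congrFun h3 k) l
    have hτl : τ l = 0 := by
      have h5 : 2 * (τ l * η l) = 0 := by linarith [h4 l]
      exact (mul_eq_zero.1 ((mul_eq_zero.1 h5).resolve_left two_ne_zero)).resolve_right hl
    funext k
    have h6 := h4 k
    rw [hτl, mul_zero, add_zero] at h6
    exact (mul_eq_zero.1 h6).resolve_right hl
  -- The vector dual to `η`: the curvature operators kill it, so their contraction `S` does too, and
  -- `N` below is `|η|²`.
  set ζ := G⁻¹ *ᵥ η with hζ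
  have hGζ : G *ᵥ ζ = η := by rw [hζ, Matrix.mulVec_mulVec, hGi, Matrix.one_mulVec]
  have hRζ : ∀ i j, R i j *ᵥ ζ = 0 := by
    intro i j
    have h1 := congrArg (· *ᵥ ζ) (hRG i j)
    simp only [Matrix.add_mulVec, ← Matrix.mulVec_mulVec, hGζ, hτ, zero_add,
      Matrix.zero_mulVec] at h1
    have h2 := congrArg (G⁻¹ *ᵥ ·) h1
    simpa [Matrix.mulVec_mulVec, ← mul_assoc, Matrix.nonsing_inv_mul _ hdet] using h2
  have hSζ : S *ᵥ ζ = 0 := by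
    funext j
    simp only [Matrix.mulVec, dotProduct, hSR, Finset.sum_mul, Pi.zero_apply]
    rw [Finset.sum_comm]
    exact Finset.sum_eq_zero fun i _ => congrFun (hRζ i j) i
  set N := η ⬝ᵥ ζ with hN
  have ha : a + b * N = 0 := by
    have h1 : (a + b * N) • η = 0 := by
      rw [← hSζ, hq, Matrix.add_mulVec, Matrix.smul_mulVec, Matrix.smul_mulVec, hGζ,
        Matrix.vecMulVec_mulVec, add_smul, mul_smul]
      simp [hN]
    exact (smul_eq_zero.1 h1).resolve_right hη
  have hNpos : N ≠ 0 := by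
    have h1 := hG.inv.dotProduct_mulVec_pos hη
    exact (by simpa using h1 : 0 < N).ne'
  have ha0 : a ≠ 0 := by
    rintro rfl
    rw [zero_add] at ha
    exact (mul_ne_zero hb0 hNpos) ha
  have hGit : (G⁻¹)ᵀ = G⁻¹ := by rw [Matrix.transpose_nonsing_inv, hGt]
  have hT : S * G⁻¹ = a • (1 : Matrix (Fin n) (Fin n) ℝ) + b • Matrix.vecMulVec η ζ := by
    rw [hq, add_mul, smul_mul_assoc, smul_mul_assoc, hGi, Matrix.vecMulVec_mul, hζ]
    rw [← Matrix.mulVec_transpose, hGit]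
  have htr : (S * G⁻¹).trace = (n - 1) * a := by
    rw [hT, Matrix.trace_add, Matrix.trace_smul, Matrix.trace_smul, Matrix.trace_one,
      Matrix.trace_vecMulVec]
    simp only [smul_eq_mul, Fintype.card_fin]
    rw [← hN]
    linear_combination ha
  have hTβ : (S * G⁻¹) *ᵥ β = a • β + (b * (ζ ⬝ᵥ β)) • η := by
    rw [hT, Matrix.add_mulVec, Matrix.smul_mulVec, Matrix.smul_mulVec, Matrix.one_mulVec,
      Matrix.vecMulVec_mulVec, mul_smul]
    simp
  rw [htr, hTβ] at heig
  -- Pairing the eigenvector equation with `ζ` makes the right side a multiple of `a + b N = 0`.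
  have hζβ : ζ ⬝ᵥ β = 0 := by
    have h1 := congrArg (ζ ⬝ᵥ ·) heig
    simp only [dotProduct_smul, dotProduct_add, smul_eq_mul, dotProduct_comm ζ η, ← hN] at h1
    have h2 : ((n - 1) * a) * (ζ ⬝ᵥ β) = 0 := by
      linear_combination h1 + 2 * (ζ ⬝ᵥ β) * ha
    refine (mul_eq_zero.1 h2).resolve_left (mul_ne_zero (by linarith) ha0)
  rw [hζβ, mul_zero, zero_smul, add_zero, smul_smul, ← sub_eq_zero, ← sub_smul] at heig
  have h3 := (smul_eq_zero.1 heig).resolve_right hβ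
  have h4 : ((n : ℝ) - 3) * a = 0 := by linarith
  rcases mul_eq_zero.1 h4 with h | h
  · linarith
  · exact ha0 h

end Algebra

/-! ## Change of coordinates -/

section ChangeOfCoordinates

variable {n : ℕ} {U V : Set (EuclideanSpace ℝ (Fin n))} {y : EuclideanSpace ℝ (Fin n)}
  {φ : EuclideanSpace ℝ (Fin n) → EuclideanSpace ℝ (Fin n)}

/-- The Jacobian matrix of a map between coordinate domains. -/
def jac (φ : EuclideanSpace ℝ (Fin n) → EuclideanSpace ℝ (Fin n))
    (y : EuclideanSpace ℝ (Fin n)) : Matrix (Fin n) (Fin n) ℝ :=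
  Matrix.of fun a i => pderiv i (fun z => φ z a) y

theorem contDiffOn_coord (hφ : ContDiffOn ℝ ∞ φ V) (a : Fin n) :
    ContDiffOn ℝ ∞ (fun z => φ z a) V := by
  have h : ContDiff ℝ ∞ fun v : EuclideanSpace ℝ (Fin n) => v a :=
    (EuclideanSpace.proj a : EuclideanSpace ℝ (Fin n) →L[ℝ] ℝ).contDiff
  exact h.comp_contDiffOn hφ

theorem smooth_jac (hV : IsOpen V) (hφ : ContDiffOn ℝ ∞ φ V) : MSmoothOn (jac φ) V :=
  fun a i => contDiffOn_pderiv hV (contDiffOn_coord hφ a) i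

theorem jac_eq_fderiv (hφ : DifferentiableAt ℝ φ y) (a i : Fin n) :
    jac φ y a i = (fderiv ℝ φ y (EuclideanSpace.single i 1)) a := by
  have h := ((EuclideanSpace.proj a : EuclideanSpace ℝ (Fin n) →L[ℝ] ℝ).hasFDerivAt.comp y
    hφ.hasFDerivAt).fderiv
  change fderiv ℝ ((EuclideanSpace.proj a : EuclideanSpace ℝ (Fin n) →L[ℝ] ℝ) ∘ φ) y _ = _
  rw [h]
  rfl

theorem clm_apply_eq_sum (L : EuclideanSpace ℝ (Fin n) →L[ℝ] ℝ) (v : EuclideanSpace ℝ (Fin n)) :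
    L v = ∑ b, v b * L (EuclideanSpace.single b 1) := by
  have hv : v = ∑ b, v b • EuclideanSpace.single b (1 : ℝ) := by
    ext c
    simp [Pi.single_apply]
  conv_lhs => rw [hv]
  simp

theorem pderiv_comp {f : EuclideanSpace ℝ (Fin n) → ℝ} (hφ : DifferentiableAt ℝ φ y)
    (hf : DifferentiableAt ℝ f (φ y)) (i : Fin n) :
    pderiv i (fun z => f (φ z)) y = ∑ b, jac φ y b i * pderiv b f (φ y) := by
  have h := (hf.hasFDerivAt.comp y hφ.hasFDerivAt).fderiv
  change fderiv ℝ (f ∘ φ) y _ = _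
  rw [h, ContinuousLinearMap.comp_apply, clm_apply_eq_sum]
  simp only [jac_eq_fderiv hφ]
  rfl

theorem mderiv_comp {F : EuclideanSpace ℝ (Fin n) → Matrix (Fin n) (Fin n) ℝ}
    (hφ : DifferentiableAt ℝ φ y) (hU : IsOpen U) (hy : φ y ∈ U) (hF : MSmoothOn F U)
    (i : Fin n) : mderiv i (fun z => F (φ z)) y = ∑ b, jac φ y b i • mderiv b F (φ y) := by
  ext c d
  simp only [Matrix.sum_apply, Matrix.smul_apply, smul_eq_mul]
  exact pderiv_comp hφ (hF.differentiableAt hU hy c d) i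

theorem MSmoothOn.comp {F : EuclideanSpace ℝ (Fin n) → Matrix (Fin n) (Fin n) ℝ}
    (hF : MSmoothOn F U) (hφ : ContDiffOn ℝ ∞ φ V) (hm : Set.MapsTo φ V U) :
    MSmoothOn (fun z => F (φ z)) V := fun a b => (hF a b).comp hφ hm

/-- The pullback of a family of connection matrices. -/
def pullConn (φ : EuclideanSpace ℝ (Fin n) → EuclideanSpace ℝ (Fin n))
    (A : Fin n → EuclideanSpace ℝ (Fin n) → Matrix (Fin n) (Fin n) ℝ) (j : Fin n)
    (z : EuclideanSpace ℝ (Fin n)) : Matrix (Fin n) (Fin n) ℝ :=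
  ∑ b, jac φ z b j • A b (φ z)

variable {A : Fin n → EuclideanSpace ℝ (Fin n) → Matrix (Fin n) (Fin n) ℝ}

theorem smooth_pullConn (hV : IsOpen V) (hφ : ContDiffOn ℝ ∞ φ V) (hm : Set.MapsTo φ V U)
    (hA : ∀ l, MSmoothOn (A l) U) (j : Fin n) : MSmoothOn (pullConn φ A j) V :=
  MSmoothOn.sum fun b _ => MSmoothOn.smul (smooth_jac hV hφ b j) ((hA b).comp hφ hm)

/-- Curvature commutes with pullback of the form index: the second derivatives of `φ` are symmetric
and drop out of the antisymmetrized derivative. -/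
theorem curv_pullConn (hV : IsOpen V) (hφ : ContDiffOn ℝ ∞ φ V) (hU : IsOpen U)
    (hm : Set.MapsTo φ V U) (hA : ∀ l, MSmoothOn (A l) U) (hy : y ∈ V) (i j : Fin n) :
    curv (pullConn φ A) i j y =
      ∑ a, ∑ b, (jac φ y a i * jac φ y b j) • curv A a b (φ y) := by
  have hd : DifferentiableAt ℝ φ y := (hφ.contDiffAt (hV.mem_nhds hy)).differentiableAt (by simp)
  have key : ∀ i j, mderiv i (pullConn φ A j) y =
      ∑ b, pderiv i (fun z => jac φ z b j) y • A b (φ y) +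
      ∑ a, ∑ b, (jac φ y a i * jac φ y b j) • mderiv a (A b) (φ y) := by
    intro i j
    have h1 : mderiv i (pullConn φ A j) y = ∑ b, mderiv i (fun z => jac φ z b j • A b (φ z)) y :=
      mderiv_sum hV hy
        (fun b _ => MSmoothOn.smul (smooth_jac hV hφ b j) ((hA b).comp hφ hm)) i
    rw [h1, Finset.sum_comm (s := Finset.univ) (f := fun a b =>
      (jac φ y a i * jac φ y b j) • mderiv a (A b) (φ y)), ← Finset.sum_add_distrib]
    refine Finset.sum_congr rfl fun b _ => ?_
    rw [mderiv_smul hV hy (smooth_jac hV hφ b j) ((hA b).comp hφ hm),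
      mderiv_comp hd hU (hm hy) (hA b), Finset.smul_sum]
    congr 1
    exact Finset.sum_congr rfl fun a _ => by rw [smul_smul, mul_comm]
  have hsym : ∀ b, pderiv i (fun z => jac φ z b j) y = pderiv j (fun z => jac φ z b i) y :=
    fun b => pderiv_comm hV hy (contDiffOn_coord hφ b) i j
  have hmul : ∀ i j, pullConn φ A i y * pullConn φ A j y =
      ∑ a, ∑ b, (jac φ y a i * jac φ y b j) • (A a (φ y) * A b (φ y)) := by
    intro i j
    simp only [pullConn, Finset.sum_mul, Finset.mul_sum, smul_mul_assoc, mul_smul_comm, Finset.smul_sum,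
      smul_smul]
    rw [Finset.sum_comm]
    exact Finset.sum_congr rfl fun a _ => Finset.sum_congr rfl fun b _ => by rw [mul_comm]
  have hswap : ∀ X : Fin n → Fin n → Matrix (Fin n) (Fin n) ℝ,
      ∑ a, ∑ b, (jac φ y a j * jac φ y b i) • X a b =
        ∑ a, ∑ b, (jac φ y a i * jac φ y b j) • X b a := by
    intro X
    rw [Finset.sum_comm]
    exact Finset.sum_congr rfl fun a _ => Finset.sum_congr rfl fun b _ => by rw [mul_comm]
  rw [curv, key, key, hmul, hmul, hswap, hswap, Finset.sum_congr rfl fun b _ => by rw [hsym b],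
    add_sub_add_left_eq_sub]
  simp only [← Finset.sum_sub_distrib, ← Finset.sum_add_distrib, ← smul_sub, ← smul_add]
  rfl

/-- Gauge covariance of the curvature. -/
theorem curv_gauge (hV : IsOpen V) {J : EuclideanSpace ℝ (Fin n) → Matrix (Fin n) (Fin n) ℝ}
    {B : Fin n → EuclideanSpace ℝ (Fin n) → Matrix (Fin n) (Fin n) ℝ}
    (hJ : MSmoothOn J V) (hA : ∀ l, MSmoothOn (A l) V) (hB : ∀ l, MSmoothOn (B l) V)
    (h : ∀ z ∈ V, ∀ j, J z * A j z = mderiv j J z + B j z * J z) (hy : y ∈ V) (i j : Fin n) :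
    J y * curv A i j y = curv B i j y * J y := by
  have key : ∀ i j, J y * mderiv i (A j) y = mderiv i (mderiv j J) y + mderiv i (B j) y * J y +
      B j y * mderiv i J y - mderiv i J y * A j y := by
    intro i j
    have h1 := mderiv_congr hV hy (fun z hz => h z hz j) i
    rw [mderiv_mul hV hy hJ (hA j), mderiv_add hV hy (hJ.mderiv hV j) ((hB j).mul hJ),
      mderiv_mul hV hy (hB j) hJ] at h1
    rw [eq_sub_iff_add_eq, add_comm, h1, add_assoc]
  have key2 : ∀ i j, J y * (A i y * A j y) =
      mderiv i J y * A j y + B i y * mderiv j J y + B i y * B j y * J y := by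
    intro i j
    rw [← mul_assoc, h y hy, add_mul, mul_assoc (B i y), h y hy]
    noncomm_ring
  simp only [curv, mul_add, mul_sub, key, key2, mderiv_comm hV hy hJ i j]
  noncomm_ring

variable {G H : EuclideanSpace ℝ (Fin n) → Matrix (Fin n) (Fin n) ℝ}

/-- `H` is the pullback of `G` under `φ`, on the open set `V` that `φ` maps to `U`. -/
structure IsPullbackOn (φ : EuclideanSpace ℝ (Fin n) → EuclideanSpace ℝ (Fin n))
    (H G : EuclideanSpace ℝ (Fin n) → Matrix (Fin n) (Fin n) ℝ)
    (V U : Set (EuclideanSpace ℝ (Fin n))) : Prop where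
  smooth : ContDiffOn ℝ ∞ φ V
  mapsTo : Set.MapsTo φ V U
  source : IsMetricOn H V
  target : IsMetricOn G U
  eq : ∀ z ∈ V, H z = (jac φ z)ᵀ * G (φ z) * jac φ z

/-- Nondegeneracy of the pulled back metric already forces the Jacobian to be invertible. -/
theorem IsPullbackOn.det_jac (h : IsPullbackOn φ H G V U) (hy : y ∈ V) : IsUnit (jac φ y).det := by
  have h1 := h.source.det_ne hy
  rw [h.eq y hy, Matrix.det_mul] at h1
  exact (right_ne_zero_of_mul h1).isUnit

/-- The transformation law of the Christoffel symbols without expanding their formula: `J⁻¹ (∂J + B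
J)`, with `B` the pulled back connection, is torsion free and compatible with `H`, so it is the
Levi-Civita connection of `H`. The law has the shape of a gauge transformation, as `curv_gauge`
requires. -/
theorem IsPullbackOn.jac_mul_conn (h : IsPullbackOn φ H G V U) (hy : y ∈ V) (j : Fin n) :
    jac φ y * conn H j y =
      mderiv j (jac φ) y + pullConn φ (conn G) j y * jac φ y := by
  have hV := h.source.isOpen
  have hU := h.target.isOpen
  have hd : DifferentiableAt ℝ φ y :=
    (h.smooth.contDiffAt (hV.mem_nhds hy)).differentiableAt (by simp)
  have hJs := smooth_jac hV h.smooth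
  set J := jac φ y with hJ
  set B : Fin n → Matrix (Fin n) (Fin n) ℝ := fun j => pullConn φ (conn G) j y with hB
  set C : Fin n → Matrix (Fin n) (Fin n) ℝ := fun j => mderiv j (jac φ) y + B j * J with hC
  have hJi : J * J⁻¹ = 1 := Matrix.mul_nonsing_inv _ (h.det_jac hy)
  have hCsymm : ∀ l a i, C l a i = C i a l := by
    intro l a i
    simp only [hC, Matrix.add_apply]
    congr 1
    · exact pderiv_comm hV hy (contDiffOn_coord h.smooth a) l i
    · simp only [hB, pullConn, Finset.sum_mul, Matrix.sum_apply, Matrix.smul_apply, smul_eq_mul,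
        Matrix.mul_apply]
      rw [Finset.sum_comm]
      exact Finset.sum_congr rfl fun b _ => Finset.sum_congr rfl fun d _ => by
        rw [h.target.conn_torsion (h.mapsTo hy) d a b]; ring
  have hu := h.source.conn_unique hy (fun j => J⁻¹ * C j) (fun l m i => ?_) (fun l => ?_) j
  · rw [hu, ← mul_assoc, hJi, one_mul]
  · simp only [Matrix.mul_apply]
    exact Finset.sum_congr rfl fun a _ => by rw [hCsymm]
  · have hGs := h.target.smooth.comp h.smooth h.mapsTo
    have hGd : mderiv l (fun z => G (φ z)) y = (B l)ᵀ * G (φ y) + G (φ y) * B l := by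
      rw [mderiv_comp hd hU (h.mapsTo hy) h.target.smooth]
      simp only [hB, pullConn, Matrix.transpose_sum, Finset.sum_mul, Finset.mul_sum,
        ← Finset.sum_add_distrib, Matrix.transpose_smul, smul_mul_assoc, mul_smul_comm, ← smul_add]
      exact Finset.sum_congr rfl fun b _ => by rw [h.target.conn_compat (h.mapsTo hy)]
    have hJc : J * (J⁻¹ * C l) = C l := by rw [← mul_assoc, hJi, one_mul]
    have h1 : H y * (J⁻¹ * C l) = Jᵀ * G (φ y) * C l := by
      rw [h.eq y hy, mul_assoc _ (jac φ y), ← hJ, hJc]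
    have h2 : (J⁻¹ * C l)ᵀ * H y = (C l)ᵀ * (G (φ y) * J) := by
      have h3 := congrArg Matrix.transpose h1
      simpa only [Matrix.transpose_mul, h.source.symm hy, h.target.symm (h.mapsTo hy),
        Matrix.transpose_transpose, mul_assoc] using h3
    rw [h1, h2, mderiv_congr hV hy h.eq, mderiv_mul hV hy (hJs.transpose.mul hGs) hJs,
      mderiv_mul hV hy hJs.transpose hGs, mderiv_transpose, hGd, ← hJ]
    simp only [hC, Matrix.transpose_add, Matrix.transpose_mul]
    noncomm_ring

/-- The Ricci tensor transforms as a tensor. -/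
theorem IsPullbackOn.ricMat_eq (h : IsPullbackOn φ H G V U) (hy : y ∈ V) :
    ricMat H y = (jac φ y)ᵀ * ricMat G (φ y) * jac φ y := by
  have hV := h.source.isOpen
  have hJi := Matrix.nonsing_inv_mul _ (h.det_jac hy)
  -- The form indices transform by pullback, the matrix indices by the gauge transformation `J`.
  have hc : ∀ a b, curv (conn H) a b y = ∑ i, ∑ j, (jac φ y i a * jac φ y j b) •
      ((jac φ y)⁻¹ * curv (conn G) i j (φ y) * jac φ y) := by
    intro a b
    have h1 := curv_gauge hV (smooth_jac hV h.smooth) h.source.smooth_conn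
      (smooth_pullConn hV h.smooth h.mapsTo h.target.smooth_conn)
      (fun z hz j => h.jac_mul_conn hz j) hy a b
    rw [curv_pullConn hV h.smooth h.target.isOpen h.mapsTo h.target.smooth_conn hy] at h1
    have h2 := congrArg ((jac φ y)⁻¹ * ·) h1
    simp only [← mul_assoc, hJi, one_mul] at h2
    rw [h2]
    simp only [Finset.sum_mul, Finset.mul_sum, smul_mul_assoc, mul_smul_comm]
  ext b c
  rw [ricMat_apply, ← contract_conj (R := fun i j => curv (conn G) i j (φ y))
    (fun j k => ricMat_apply j k) (Matrix.mul_nonsing_inv _ (h.det_jac hy))]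
  exact Finset.sum_congr rfl fun a _ => by rw [hc]

theorem IsPullbackOn.inv_eq (h : IsPullbackOn φ H G V U) (hy : y ∈ V) :
    (H y)⁻¹ = (jac φ y)⁻¹ * (G (φ y))⁻¹ * ((jac φ y)⁻¹)ᵀ := by
  rw [h.eq y hy, Matrix.mul_inv_rev, Matrix.mul_inv_rev, Matrix.transpose_nonsing_inv, mul_assoc]

/-- The mixed tensor changes by conjugation, so `sc` and `|Ri|²`, traces of its powers, are
independent of the chart. -/
theorem IsPullbackOn.ricUp_eq (h : IsPullbackOn φ H G V U) (hy : y ∈ V) :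
    ricUp H y = (jac φ y)ᵀ * ricUp G (φ y) * ((jac φ y)⁻¹)ᵀ := by
  rw [ricUp, h.ricMat_eq hy, h.inv_eq hy, ricUp]
  calc _ = (jac φ y)ᵀ * ricMat G (φ y) * (jac φ y * (jac φ y)⁻¹) * (G (φ y))⁻¹ *
        ((jac φ y)⁻¹)ᵀ := by simp only [mul_assoc]
    _ = _ := by
        rw [Matrix.mul_nonsing_inv _ (h.det_jac hy)]
        simp only [mul_assoc, mul_one]

theorem IsPullbackOn.inv_transpose_mul (h : IsPullbackOn φ H G V U) (hy : y ∈ V) :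
    ((jac φ y)⁻¹)ᵀ * (jac φ y)ᵀ = 1 := by
  rw [← Matrix.transpose_mul, Matrix.mul_nonsing_inv _ (h.det_jac hy), Matrix.transpose_one]

theorem IsPullbackOn.trace_eq (h : IsPullbackOn φ H G V U) (hy : y ∈ V) :
    (ricUp H y).trace = (ricUp G (φ y)).trace := by
  rw [h.ricUp_eq hy, Matrix.trace_mul_cycle, h.inv_transpose_mul hy, one_mul]

theorem IsPullbackOn.ricNormSq_eq (h : IsPullbackOn φ H G V U) (hy : y ∈ V) :
    ricNormSq H y = ricNormSq G (φ y) := by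
  have h1 : ricUp H y * ricUp H y =
      (jac φ y)ᵀ * (ricUp G (φ y) * ricUp G (φ y)) * ((jac φ y)⁻¹)ᵀ := by
    rw [h.ricUp_eq hy]
    calc _ = (jac φ y)ᵀ * ricUp G (φ y) * (((jac φ y)⁻¹)ᵀ * (jac φ y)ᵀ) * ricUp G (φ y) *
          ((jac φ y)⁻¹)ᵀ := by simp only [mul_assoc]
      _ = _ := by
          rw [h.inv_transpose_mul hy]
          simp only [mul_assoc, one_mul]
  rw [ricNormSq, h1, Matrix.trace_mul_cycle, h.inv_transpose_mul hy, one_mul, ricNormSq]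

end ChangeOfCoordinates

/-! ## Charts of a Riemannian manifold -/

section Charts

variable {n : ℕ} {M : Type*} [TopologicalSpace M]
  {e e' : OpenPartialHomeomorph M (EuclideanSpace ℝ (Fin n))} {y : EuclideanSpace ℝ (Fin n)}

/-- The transition map from the chart `e'` to the chart `e`. -/
def transition (e' e : OpenPartialHomeomorph M (EuclideanSpace ℝ (Fin n)))
    (z : EuclideanSpace ℝ (Fin n)) : EuclideanSpace ℝ (Fin n) := e (e'.symm z)

/-- The domain of the transition map from the chart `e'` to the chart `e`. -/
def overlap (e' e : OpenPartialHomeomorph M (EuclideanSpace ℝ (Fin n))) :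
    Set (EuclideanSpace ℝ (Fin n)) := e'.target ∩ e'.symm ⁻¹' e.source

theorem isOpen_overlap : IsOpen (overlap e' e) := e'.isOpen_inter_preimage_symm e.open_source

theorem mapsTo_transition : Set.MapsTo (transition e' e) (overlap e' e) e.target :=
  fun _ hz => e.map_source hz.2

theorem symm_transition (hy : y ∈ overlap e' e) : e.symm (transition e' e y) = e'.symm y :=
  e.left_inv hy.2

variable [ChartedSpace (EuclideanSpace ℝ (Fin n)) M]

/-- The derivative of the inverse of a chart, as a map of the model space. -/
def chartDeriv (e : OpenPartialHomeomorph M (EuclideanSpace ℝ (Fin n)))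
    (y : EuclideanSpace ℝ (Fin n)) : EuclideanSpace ℝ (Fin n) →L[ℝ] EuclideanSpace ℝ (Fin n) :=
  mfderiv (𝓡 n) (𝓡 n) e.symm y

theorem mdifferentiableAt_symm (he : e ∈ IsManifold.maximalAtlas (𝓡 n) ∞ M) (hy : y ∈ e.target) :
    MDifferentiableAt (𝓡 n) (𝓡 n) e.symm y :=
  (contMDiffAt_symm_of_mem_maximalAtlas he hy).mdifferentiableAt (by simp)

theorem mdifferentiableAt_chart (he : e ∈ IsManifold.maximalAtlas (𝓡 n) ∞ M) {p : M}
    (hp : p ∈ e.source) : MDifferentiableAt (𝓡 n) (𝓡 n) e p :=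
  (contMDiffAt_of_mem_maximalAtlas he hp).mdifferentiableAt (by simp)

theorem contDiffOn_transition (he : e ∈ IsManifold.maximalAtlas (𝓡 n) ∞ M)
    (he' : e' ∈ IsManifold.maximalAtlas (𝓡 n) ∞ M) :
    ContDiffOn ℝ ∞ (transition e' e) (overlap e' e) := by
  rw [← contMDiffOn_iff_contDiffOn]
  exact (contMDiffOn_of_mem_maximalAtlas he).comp
    ((contMDiffOn_symm_of_mem_maximalAtlas he').mono Set.inter_subset_left)
    Set.inter_subset_right

theorem chartDeriv_transition (he : e ∈ IsManifold.maximalAtlas (𝓡 n) ∞ M)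
    (he' : e' ∈ IsManifold.maximalAtlas (𝓡 n) ∞ M) (hy : y ∈ overlap e' e) :
    chartDeriv e' y =
      (chartDeriv e (transition e' e y)).comp (fderiv ℝ (transition e' e) y) := by
  have hev : e'.symm =ᶠ[𝓝 y] e.symm ∘ transition e' e := by
    filter_upwards [isOpen_overlap.mem_nhds hy] with z hz
    exact (symm_transition hz).symm
  have hd : MDifferentiableAt (𝓡 n) (𝓡 n) (transition e' e) y :=
    (((contDiffOn_transition he he').contDiffAt (isOpen_overlap.mem_nhds hy)).differentiableAt
      (by simp)).mdifferentiableAt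
  have h1 := mfderiv_comp y (mdifferentiableAt_symm he (mapsTo_transition hy)) hd
  have h2 : chartDeriv e' y = mfderiv (𝓡 n) (𝓡 n) (e.symm ∘ transition e' e) y :=
    hev.mfderiv_eq
  rw [h2, h1, ← mfderiv_eq_fderiv]
  rfl

/-- The chain rule for `e ∘ e.symm = id`. The resulting injectivity of `chartDeriv` gives positivity
of the metric matrix and makes the components determine a covector. -/
theorem mfderiv_chart_chartDeriv (he : e ∈ IsManifold.maximalAtlas (𝓡 n) ∞ M)
    (hy : y ∈ e.target) (v : EuclideanSpace ℝ (Fin n)) :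
    (mfderiv (𝓡 n) (𝓡 n) e (e.symm y) (chartDeriv e y v) : EuclideanSpace ℝ (Fin n)) = v := by
  have h1 := mfderiv_comp y (mdifferentiableAt_chart he (e.map_target hy))
    (mdifferentiableAt_symm he hy)
  have hev : e ∘ e.symm =ᶠ[𝓝 y] id := by
    filter_upwards [e.open_target.mem_nhds hy] with z hz
    exact e.right_inv hz
  have h2 : mfderiv (𝓡 n) (𝓡 n) (e ∘ e.symm) y = mfderiv (𝓡 n) (𝓡 n) id y := hev.mfderiv_eq
  rw [h2, mfderiv_id] at h1
  exact (congrArg (fun L : EuclideanSpace ℝ (Fin n) →L[ℝ] EuclideanSpace ℝ (Fin n) => L v) h1).symm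

theorem chartDeriv_single (he : e ∈ IsManifold.maximalAtlas (𝓡 n) ∞ M)
    (he' : e' ∈ IsManifold.maximalAtlas (𝓡 n) ∞ M) (hy : y ∈ overlap e' e) (i : Fin n) :
    chartDeriv e' y (EuclideanSpace.single i 1) = ∑ a, jac (transition e' e) y a i •
      chartDeriv e (transition e' e y) (EuclideanSpace.single a 1) := by
  have hd : DifferentiableAt ℝ (transition e' e) y :=
    ((contDiffOn_transition he he').contDiffAt (isOpen_overlap.mem_nhds hy)).differentiableAt
      (by simp)
  rw [chartDeriv_transition he he' hy, ContinuousLinearMap.comp_apply]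
  have hv : fderiv ℝ (transition e' e) y (EuclideanSpace.single i 1) =
      ∑ a, jac (transition e' e) y a i • EuclideanSpace.single a (1 : ℝ) := by
    ext c
    simp [jac_eq_fderiv hd, Pi.single_apply]
  rw [hv, map_sum]
  simp

theorem formCoeff_transition (η : ∀ p : M, TangentSpace (𝓡 n) p →L[ℝ] ℝ)
    (he : e ∈ IsManifold.maximalAtlas (𝓡 n) ∞ M)
    (he' : e' ∈ IsManifold.maximalAtlas (𝓡 n) ∞ M) (hy : y ∈ overlap e' e) (i : Fin n) :
    formCoeff η e' i y =
      ∑ a, jac (transition e' e) y a i * formCoeff η e a (transition e' e y) := by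
  set η' : M → EuclideanSpace ℝ (Fin n) →L[ℝ] ℝ := fun p => η p with hη'
  change η' (e'.symm y) (chartDeriv e' y (EuclideanSpace.single i 1)) = ∑ a, _ * η'
    (e.symm (transition e' e y)) (chartDeriv e (transition e' e y) (EuclideanSpace.single a 1))
  rw [chartDeriv_single he he' hy, symm_transition hy]
  simp

variable [IsManifold (𝓡 n) ∞ M]

theorem contMDiffAt_coordVec (he : e ∈ IsManifold.maximalAtlas (𝓡 n) ∞ M) (hy : y ∈ e.target)
    (i : Fin n) :
    ContMDiffAt (𝓡 n) ((𝓡 n).prod (𝓡 n)) ∞ (fun z => Bundle.TotalSpace.mk'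
      (EuclideanSpace ℝ (Fin n)) (E := fun p : M => TangentSpace (𝓡 n) p)
      (e.symm z) (coordVec e i z)) y := by
  have hs := contMDiffAt_symm_of_mem_maximalAtlas he hy
  have hv : ContMDiffAt (𝓡 n) ((𝓡 n).prod (𝓡 n)) ∞ (fun z : EuclideanSpace ℝ (Fin n) =>
      Bundle.TotalSpace.mk' (EuclideanSpace ℝ (Fin n))
        (E := fun p : EuclideanSpace ℝ (Fin n) => TangentSpace (𝓡 n) p)
      z (EuclideanSpace.single i (1 : ℝ) : EuclideanSpace ℝ (Fin n))) y :=
    contMDiffAt_vectorSpace_iff_contDiffAt.2 contDiffAt_const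
  exact ContMDiffAt.clm_apply_of_inCoordinates (ContMDiffAt.mfderiv_const hs (by simp)) hv hs

theorem contDiffOn_formCoeff {η : ∀ p : M, TangentSpace (𝓡 n) p →L[ℝ] ℝ}
    (hη : SmoothOneFormOn η Set.univ) (he : e ∈ IsManifold.maximalAtlas (𝓡 n) ∞ M) (i : Fin n) :
    ContDiffOn ℝ ∞ (formCoeff η e i) e.target := by
  intro y hy
  have h1 : ContMDiffAt (𝓡 n) ((𝓡 n).prod 𝓘(ℝ, ℝ)) ∞ (fun z => Bundle.TotalSpace.mk' ℝ
      (E := Bundle.Trivial M ℝ) (e.symm z) (η (e.symm z) (coordVec e i z))) y :=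
    ContMDiffAt.clm_bundle_apply (F₁ := EuclideanSpace ℝ (Fin n)) (F₂ := ℝ)
      (E₁ := fun p : M => TangentSpace (𝓡 n) p) (E₂ := Bundle.Trivial M ℝ) (b := e.symm)
      (ϕ := fun z => η (e.symm z)) (v := fun z => coordVec e i z)
      (ContMDiffAt.comp y ((hη _ (Set.mem_univ _)).contMDiffAt Filter.univ_mem)
        (contMDiffAt_symm_of_mem_maximalAtlas he hy))
      (contMDiffAt_coordVec he hy i)
  rw [Bundle.contMDiffAt_totalSpace] at h1
  exact (contMDiffAt_iff_contDiffAt.1 h1.2).contDiffWithinAt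

/-- The metric as a bilinear form of the model space. -/
def innerForm (g : Metric n M) (p : M) :
    EuclideanSpace ℝ (Fin n) →L[ℝ] EuclideanSpace ℝ (Fin n) →L[ℝ] ℝ := g.inner p

theorem metricCoeff_apply (g : Metric n M) (y : EuclideanSpace ℝ (Fin n)) (i j : Fin n) :
    metricCoeff g e y i j = innerForm g (e.symm y)
      (chartDeriv e y (EuclideanSpace.single i 1)) (chartDeriv e y (EuclideanSpace.single j 1)) :=
  rfl

theorem dotProduct_metricCoeff (g : Metric n M) (v : EuclideanSpace ℝ (Fin n)) :
    (v : Fin n → ℝ) ⬝ᵥ (metricCoeff g e y *ᵥ v) =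
      innerForm g (e.symm y) (chartDeriv e y v) (chartDeriv e y v) := by
  set B : EuclideanSpace ℝ (Fin n) →L[ℝ] EuclideanSpace ℝ (Fin n) →L[ℝ] ℝ :=
    innerForm g (e.symm y) with hB
  have h1 := clm_apply_eq_sum ((B.flip (chartDeriv e y v)).comp (chartDeriv e y)) v
  simp only [ContinuousLinearMap.comp_apply, ContinuousLinearMap.flip_apply] at h1
  rw [h1, dotProduct]
  refine Finset.sum_congr rfl fun i _ => ?_
  congr 1
  have h2 := clm_apply_eq_sum
    ((B (chartDeriv e y (EuclideanSpace.single i 1))).comp (chartDeriv e y)) v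
  simp only [ContinuousLinearMap.comp_apply] at h2
  rw [h2, Matrix.mulVec, dotProduct]
  exact Finset.sum_congr rfl fun j _ => by rw [metricCoeff_apply, mul_comm]

theorem smooth_metricCoeff (g : Metric n M) (he : e ∈ IsManifold.maximalAtlas (𝓡 n) ∞ M) :
    MSmoothOn (metricCoeff g e) e.target := by
  intro i j y hy
  have h1 : ContMDiffAt (𝓡 n) ((𝓡 n).prod 𝓘(ℝ, ℝ)) ∞ (fun z => Bundle.TotalSpace.mk' ℝ
      (E := Bundle.Trivial M ℝ) (e.symm z)
      (g.inner (e.symm z) (coordVec e i z) (coordVec e j z))) y := by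
    apply ContMDiffAt.clm_bundle_apply₂ (F₁ := EuclideanSpace ℝ (Fin n))
      (F₂ := EuclideanSpace ℝ (Fin n))
    · exact ContMDiffAt.comp y (g.contMDiff _) (contMDiffAt_symm_of_mem_maximalAtlas he hy)
    · exact contMDiffAt_coordVec he hy i
    · exact contMDiffAt_coordVec he hy j
  rw [Bundle.contMDiffAt_totalSpace] at h1
  exact (contMDiffAt_iff_contDiffAt.1 h1.2).contDiffWithinAt

theorem isMetricOn_metricCoeff (g : Metric n M) (he : e ∈ IsManifold.maximalAtlas (𝓡 n) ∞ M) :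
    IsMetricOn (metricCoeff g e) e.target := by
  refine ⟨e.open_target, smooth_metricCoeff g he, fun z hz => ?_⟩
  refine Matrix.PosDef.of_dotProduct_mulVec_pos ?_ fun x hx => ?_
  · ext i j
    exact g.symm _ _ _
  · have h1 := dotProduct_metricCoeff (e := e) (y := z) g (WithLp.toLp 2 x)
    have h2 : chartDeriv e z (WithLp.toLp 2 x) ≠ 0 := by
      intro h
      have h3 := mfderiv_chart_chartDeriv he hz (WithLp.toLp 2 x)
      rw [h] at h3
      apply hx
      have h4 : (WithLp.toLp 2 x : EuclideanSpace ℝ (Fin n)) = 0 := by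
        rw [← h3]
        exact map_zero (mfderiv (𝓡 n) (𝓡 n) e (e.symm z))
      funext i
      exact congrFun (congrArg WithLp.ofLp h4) i
    have h5 : 0 < innerForm g (e.symm z) (chartDeriv e z (WithLp.toLp 2 x))
        (chartDeriv e z (WithLp.toLp 2 x)) := g.pos _ _ h2
    rw [← h1] at h5
    simpa using h5

theorem isPullbackOn_metricCoeff (g : Metric n M) (he : e ∈ IsManifold.maximalAtlas (𝓡 n) ∞ M)
    (he' : e' ∈ IsManifold.maximalAtlas (𝓡 n) ∞ M) :
    IsPullbackOn (transition e' e) (metricCoeff g e') (metricCoeff g e) (overlap e' e)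
      e.target := by
  refine ⟨contDiffOn_transition he he', mapsTo_transition,
    (isMetricOn_metricCoeff g he').mono isOpen_overlap Set.inter_subset_left,
    isMetricOn_metricCoeff g he, fun z hz => ?_⟩
  ext i j
  rw [metricCoeff_apply, chartDeriv_single he he' hz, chartDeriv_single he he' hz]
  simp only [Matrix.mul_apply, metricCoeff_apply, Matrix.transpose_apply, symm_transition hz,
    map_sum, map_smul, sum_apply, smul_apply, smul_eq_mul,
    Finset.sum_mul, Finset.mul_sum]
  exact Finset.sum_congr rfl fun a _ => Finset.sum_congr rfl fun b _ => by ring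

end Charts

/-! ## Solutions of homogeneous first order systems on a connected manifold -/

section Nonvanishing

variable {n : ℕ}

/-- Along the segment from `a` to `b` the function satisfies `u' = k u`, with `k` bounded by
compactness, so Grönwall's inequality propagates the zero at `a`. -/
theorem eq_zero_of_pderiv_eq_mul {F : EuclideanSpace ℝ (Fin n) → ℝ}
    {c : Fin n → EuclideanSpace ℝ (Fin n) → ℝ} {s : Set (EuclideanSpace ℝ (Fin n))}
    (hs : Convex ℝ s) (hF : ∀ z ∈ s, DifferentiableAt ℝ F z) (hc : ∀ i, ContinuousOn (c i) s)
    (h : ∀ z ∈ s, ∀ i, pderiv i F z = c i z * F z) {a b : EuclideanSpace ℝ (Fin n)}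
    (ha : a ∈ s) (hb : b ∈ s) (h0 : F a = 0) : F b = 0 := by
  set γ : ℝ → EuclideanSpace ℝ (Fin n) := fun t => AffineMap.lineMap a b t with hγ
  have hγs : ∀ t ∈ Set.Icc (0 : ℝ) 1, γ t ∈ s := fun t ht => hs.lineMap_mem ha hb ht
  have hγd : ∀ t, HasDerivAt γ (b - a) t := fun t => AffineMap.hasDerivAt_lineMap
  set k : ℝ → ℝ := fun t => ∑ i, (b - a) i * c i (γ t) with hk
  have hkc : ContinuousOn k (Set.Icc 0 1) := by
    refine continuousOn_finsetSum _ fun i _ => continuousOn_const.mul ?_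
    exact (hc i).comp (fun t _ => (hγd t).continuousAt.continuousWithinAt) hγs
  obtain ⟨K, hK⟩ := isCompact_Icc.exists_bound_of_continuousOn hkc
  have hder : ∀ t ∈ Set.Icc (0 : ℝ) 1, HasDerivAt (fun t => F (γ t)) (k t * F (γ t)) t := by
    intro t ht
    have h1 := (hF _ (hγs t ht)).hasFDerivAt.comp_hasDerivAt t (hγd t)
    have h2 : fderiv ℝ F (γ t) (b - a) = k t * F (γ t) := by
      rw [clm_apply_eq_sum, hk, Finset.sum_mul]
      refine Finset.sum_congr rfl fun i _ => ?_
      rw [mul_assoc, ← h _ (hγs t ht) i]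
      rfl
    rw [← h2]
    exact h1
  have h3 := eq_zero_of_abs_deriv_le_mul_abs_self_of_eq_zero_right (K := K)
    (fun t ht => (hder t ht).continuousAt.continuousWithinAt)
    (fun t ht => (hder t (Set.Ico_subset_Icc_self ht)).hasDerivWithinAt) (by simpa [hγ] using h0)
    (fun t ht => by
      rw [norm_mul]
      exact mul_le_mul_of_nonneg_right (hK t (Set.Ico_subset_Icc_self ht)) (norm_nonneg _))
    1 (by simp)
  simpa [hγ] using h3

variable {M : Type*} [TopologicalSpace M] [ChartedSpace (EuclideanSpace ℝ (Fin n)) M]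

/-- In a coordinate ball a zero at one point spreads to every other, so the proposition `f p = 0` is
locally constant, hence constant on `M`. -/
theorem forall_ne_zero_of_pderiv_eq_mul [ConnectedSpace M] {f : M → ℝ}
    (hf : ∀ p : M, ∃ c : Fin n → EuclideanSpace ℝ (Fin n) → ℝ,
      (∀ i, ContinuousOn (c i) (chartAt (EuclideanSpace ℝ (Fin n)) p).target) ∧
      ∀ z ∈ (chartAt (EuclideanSpace ℝ (Fin n)) p).target,
        DifferentiableAt ℝ (fun z => f ((chartAt (EuclideanSpace ℝ (Fin n)) p).symm z)) z ∧
        ∀ i, pderiv i (fun z => f ((chartAt (EuclideanSpace ℝ (Fin n)) p).symm z)) z =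
          c i z * f ((chartAt (EuclideanSpace ℝ (Fin n)) p).symm z))
    (hne : ∃ p, f p ≠ 0) (p : M) : f p ≠ 0 := by
  have hloc : IsLocallyConstant fun p => f p = 0 := by
    rw [IsLocallyConstant.iff_eventually_eq]
    intro p
    obtain ⟨c, hc, h⟩ := hf p
    set e := chartAt (EuclideanSpace ℝ (Fin n)) p with he
    have hp : p ∈ e.source := mem_chart_source _ p
    obtain ⟨r, hr, hball⟩ := Metric.isOpen_iff.1 e.open_target (e p) (e.map_source hp)
    have hV : e.source ∩ e ⁻¹' Metric.ball (e p) r ∈ 𝓝 p :=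
      (e.isOpen_inter_preimage Metric.isOpen_ball).mem_nhds ⟨hp, Metric.mem_ball_self hr⟩
    filter_upwards [hV] with q hq
    have key := fun a b ha hb => eq_zero_of_pderiv_eq_mul (F := fun z => f (e.symm z)) (c := c)
      (convex_ball (e p) r) (fun z hz => (h z (hball hz)).1) (fun i => (hc i).mono hball)
      (fun z hz => (h z (hball hz)).2) (a := a) (b := b) ha hb
    have h1 := key (e p) (e q) (Metric.mem_ball_self hr) hq.2
    have h2 := key (e q) (e p) hq.2 (Metric.mem_ball_self hr)
    rw [e.left_inv hp, e.left_inv hq.1] at h1 h2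
    exact propext ⟨h2, h1⟩
  obtain ⟨q, hq⟩ := hne
  intro h
  exact hq ((hloc.apply_eq_of_preconnectedSpace p q).mp h)

end Nonvanishing

/-! ## One-forms given in a chart -/

section OneForms

variable {n : ℕ} {M : Type*} [TopologicalSpace M] [ChartedSpace (EuclideanSpace ℝ (Fin n)) M]
  {e : OpenPartialHomeomorph M (EuclideanSpace ℝ (Fin n))} {y : EuclideanSpace ℝ (Fin n)}

/-- The covector with components `c` at `z`. -/
def covector (c : Fin n → EuclideanSpace ℝ (Fin n) → ℝ) (z : EuclideanSpace ℝ (Fin n)) :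
    EuclideanSpace ℝ (Fin n) →L[ℝ] ℝ :=
  ∑ i, c i z • (EuclideanSpace.proj i : EuclideanSpace ℝ (Fin n) →L[ℝ] ℝ)

/-- The one-form with components `c` in the chart `e`. -/
def chartForm (e : OpenPartialHomeomorph M (EuclideanSpace ℝ (Fin n)))
    (c : Fin n → EuclideanSpace ℝ (Fin n) → ℝ) (p : M) : TangentSpace (𝓡 n) p →L[ℝ] ℝ :=
  (covector c (e p)).comp (mfderiv (𝓡 n) (𝓡 n) e p :
    EuclideanSpace ℝ (Fin n) →L[ℝ] EuclideanSpace ℝ (Fin n))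

theorem formCoeff_chartForm (he : e ∈ IsManifold.maximalAtlas (𝓡 n) ∞ M) (hy : y ∈ e.target)
    (c : Fin n → EuclideanSpace ℝ (Fin n) → ℝ) (i : Fin n) :
    formCoeff (chartForm e c) e i y = c i y := by
  have h1 : formCoeff (chartForm e c) e i y = covector c (e (e.symm y))
      (mfderiv (𝓡 n) (𝓡 n) e (e.symm y) (chartDeriv e y (EuclideanSpace.single i 1))) := rfl
  have h2 := mfderiv_chart_chartDeriv he hy (EuclideanSpace.single i 1)
  rw [h1, e.right_inv hy]
  refine (congrArg (covector c y) h2).trans ?_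
  simp [covector]

/-- The coordinate vectors span: an injective endomorphism of a finite-dimensional space is onto. -/
theorem eq_zero_of_formCoeff {η : ∀ p : M, TangentSpace (𝓡 n) p →L[ℝ] ℝ}
    (he : e ∈ IsManifold.maximalAtlas (𝓡 n) ∞ M) (hy : y ∈ e.target)
    (h : ∀ i, formCoeff η e i y = 0) : η (e.symm y) = 0 := by
  have hinj : Function.Injective (chartDeriv e y).toLinearMap := fun v w hvw => by
    have h1 := mfderiv_chart_chartDeriv he hy v
    have h2 := mfderiv_chart_chartDeriv he hy w
    rw [← h1, ← h2]
    exact congrArg (mfderiv (𝓡 n) (𝓡 n) e (e.symm y)) hvw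
  have hsurj := LinearMap.injective_iff_surjective.1 hinj
  set L : EuclideanSpace ℝ (Fin n) →L[ℝ] ℝ := η (e.symm y) with hL
  have h0 : L = 0 := by
    ext w
    obtain ⟨v, rfl⟩ := hsurj w
    have h3 := clm_apply_eq_sum (L.comp (chartDeriv e y)) v
    refine h3.trans (Finset.sum_eq_zero fun i _ => ?_)
    rw [show (L.comp (chartDeriv e y)) (EuclideanSpace.single i 1) = 0 from h i, mul_zero]
  exact h0

variable [IsManifold (𝓡 n) ∞ M]

theorem smoothOneFormOn_chartForm (he : e ∈ IsManifold.maximalAtlas (𝓡 n) ∞ M)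
    {c : Fin n → EuclideanSpace ℝ (Fin n) → ℝ} {s : Set (EuclideanSpace ℝ (Fin n))}
    (hs : IsOpen s) (hc : ∀ i, ContDiffOn ℝ ∞ (c i) s) :
    SmoothOneFormOn (chartForm e c) (e.source ∩ e ⁻¹' s) := by
  intro p hp
  refine ContMDiffAt.contMDiffWithinAt ?_
  have hep := contMDiffAt_of_mem_maximalAtlas he hp.1
  rw [contMDiffAt_hom_bundle]
  refine ⟨contMDiffAt_id, ?_⟩
  have hL : ContMDiffAt (𝓡 n) 𝓘(ℝ, EuclideanSpace ℝ (Fin n) →L[ℝ] ℝ) ∞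
      (fun q => covector c (e q)) p := by
    have h1 : ContDiffAt ℝ ∞ (covector c) (e p) := by
      unfold covector
      refine ContDiffAt.sum fun i _ => ?_
      exact ((hc i).contDiffAt (hs.mem_nhds hp.2)).smul contDiffAt_const
    exact h1.contMDiffAt.comp p hep
  refine (hL.clm_comp (ContMDiffAt.mfderiv_const hep (m := ∞) (by simp))).congr_of_eventuallyEq ?_
  refine Filter.Eventually.of_forall fun q => ?_
  ext v
  simp [ContinuousLinearMap.inCoordinates, inTangentCoordinates, chartForm]
  rfl

end OneForms

/-! ## Recurrent Ricci tensors on manifolds -/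

section Global

variable {n : ℕ}

/-- The expression is the sum of the squared differences of the three eigenvalues. If it vanished,
`S` would be `λ G`, the eigenvector equation would read `3λβ = 2λβ`, and `S` would be zero. -/
theorem trace_sq_sub_ne_zero {G S : Matrix (Fin 3) (Fin 3) ℝ} (hG : G.PosDef) (hS : Sᵀ = S)
    {β : Fin 3 → ℝ} (hβ : β ≠ 0) (heig : (S * G⁻¹).trace • β = (2 : ℝ) • ((S * G⁻¹) *ᵥ β))
    (hne : (S * G⁻¹ * (S * G⁻¹)).trace ≠ 0) :
    3 * (S * G⁻¹ * (S * G⁻¹)).trace - (S * G⁻¹).trace ^ 2 ≠ 0 := by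
  intro h
  obtain ⟨M, d, hM, hd⟩ := exists_frame hG hS
  obtain ⟨t1, t2⟩ := trace_frame hM hd
  obtain ⟨e1, e2⟩ := eq_of_frame hM hd
  rw [t2] at hne
  rw [t1, t2] at h
  simp only [Fin.sum_univ_three] at h hne
  have h1 : d 1 = d 0 := by
    nlinarith [sq_nonneg (d 0 - d 1), sq_nonneg (d 0 - d 2), sq_nonneg (d 1 - d 2)]
  have h2 : d 2 = d 0 := by
    nlinarith [sq_nonneg (d 0 - d 1), sq_nonneg (d 0 - d 2), sq_nonneg (d 1 - d 2)]
  have hSG : S = d 0 • G := by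
    ext i j
    rw [Matrix.smul_apply, e1, e2]
    simp only [Fin.sum_univ_three, h1, h2, smul_eq_mul]
    ring
  rw [t1, hSG, smul_mul_assoc, Matrix.mul_nonsing_inv _ hG.det_pos.ne'.isUnit, Matrix.smul_mulVec,
    Matrix.one_mulVec, smul_smul, ← sub_eq_zero, ← sub_smul] at heig
  have h3 := (smul_eq_zero.1 heig).resolve_right hβ
  simp only [Fin.sum_univ_three, h1, h2] at h3
  have h4 : d 0 = 0 := by linarith
  exact hne (by rw [h1, h2, h4]; ring)

variable {U : Set (EuclideanSpace ℝ (Fin n))} {y : EuclideanSpace ℝ (Fin n)}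
  {G : EuclideanSpace ℝ (Fin n) → Matrix (Fin n) (Fin n) ℝ}
  {β : Fin n → EuclideanSpace ℝ (Fin n) → ℝ}

theorem IsMetricOn.ricNormSq_nonneg (hG : IsMetricOn G U) (hy : y ∈ U) : 0 ≤ ricNormSq G y :=
  trace_sq_nonneg (hG.posDef y hy) (hG.ricMat_symm hy)

theorem IsMetricOn.ricMat_eq_zero (hG : IsMetricOn G U) (hy : y ∈ U) (h : ricNormSq G y = 0) :
    ricMat G y = 0 :=
  eq_zero_of_trace_sq (hG.posDef y hy) (hG.ricMat_symm hy) h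

theorem RecurrentOn.eigen_smul (hβ : RecurrentOn G β U) (hG : IsMetricOn G U) (hy : y ∈ U) :
    (ricMat G y * (G y)⁻¹).trace • (fun l => β l y) =
      (2 : ℝ) • ((ricMat G y * (G y)⁻¹) *ᵥ fun l => β l y) := by
  funext k
  have h := hβ.eigen hG hy k
  simp only [Pi.smul_apply, smul_eq_mul]
  rw [mul_comm]
  exact h

variable {M : Type*} [TopologicalSpace M] [ChartedSpace (EuclideanSpace ℝ (Fin n)) M]
  {e : OpenPartialHomeomorph M (EuclideanSpace ℝ (Fin n))}

theorem mem_overlap_chartAt (hy : y ∈ e.target) :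
    y ∈ overlap e (chartAt (EuclideanSpace ℝ (Fin n)) (e.symm y)) :=
  ⟨hy, mem_chart_source _ _⟩

variable [IsManifold (𝓡 n) ∞ M]

/-- The squared norm of the Ricci tensor as a function on the manifold. -/
def ricciNormSq (g : Metric n M) (p : M) : ℝ :=
  ricNormSq (metricCoeff g (chartAt (EuclideanSpace ℝ (Fin n)) p))
    (chartAt (EuclideanSpace ℝ (Fin n)) p p)

theorem ricciNormSq_eq (g : Metric n M) (he : e ∈ IsManifold.maximalAtlas (𝓡 n) ∞ M)
    (hy : y ∈ e.target) : ricciNormSq g (e.symm y) = ricNormSq (metricCoeff g e) y :=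
  ((isPullbackOn_metricCoeff g (IsManifold.chart_mem_maximalAtlas _) he).ricNormSq_eq
    (mem_overlap_chartAt hy)).symm

theorem scalarCurvature_eq (g : Metric n M) (he : e ∈ IsManifold.maximalAtlas (𝓡 n) ∞ M)
    (hy : y ∈ e.target) :
    scalarCurvature g (e.symm y) = (ricUp (metricCoeff g e) y).trace := by
  have hc := IsManifold.chart_mem_maximalAtlas (I := 𝓡 n) (n := ∞) (e.symm y)
  rw [scalarCurvature, (isMetricOn_metricCoeff g hc).scalar_eq_trace (mem_chart_target _ _)]
  exact ((isPullbackOn_metricCoeff g hc he).trace_eq (mem_overlap_chartAt hy)).symm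

/-- The definition uses a chart that varies with the point; near `p` invariance allows the single
chart at `p` to be used instead. -/
theorem contMDiff_scalarCurvature (g : Metric n M) :
    ContMDiff (𝓡 n) 𝓘(ℝ) ∞ (scalarCurvature g) := by
  intro p
  set e := chartAt (EuclideanSpace ℝ (Fin n)) p with he
  have hp : p ∈ e.source := mem_chart_source _ p
  have hc : e ∈ IsManifold.maximalAtlas (𝓡 n) ∞ M := IsManifold.chart_mem_maximalAtlas p
  have hG := isMetricOn_metricCoeff g hc
  have h1 : ContDiffAt ℝ ∞ (fun z => (ricUp (metricCoeff g e) z).trace) (e p) :=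
    hG.smooth_ricUp.trace.contDiffAt (e.open_target.mem_nhds (e.map_source hp))
  refine (h1.contMDiffAt.comp p (contMDiffAt_of_mem_maximalAtlas hc hp)).congr_of_eventuallyEq ?_
  filter_upwards [e.open_source.mem_nhds hp] with q hq
  have h2 := scalarCurvature_eq g hc (e.map_source hq)
  rw [e.left_inv hq] at h2
  exact h2

/-- The Ricci tensor is recurrent with recurrence form `η`. -/
def RecurrentWith (g : Metric n M) (η : ∀ p : M, TangentSpace (𝓡 n) p →L[ℝ] ℝ) : Prop :=
  ∀ e ∈ IsManifold.maximalAtlas (𝓡 n) ∞ M,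
    RecurrentOn (metricCoeff g e) (formCoeff η e) e.target

variable {g : Metric n M} {η : ∀ p : M, TangentSpace (𝓡 n) p →L[ℝ] ℝ}

/-- A recurrent Ricci tensor that does not vanish identically vanishes nowhere. -/
theorem RecurrentWith.ricciNormSq_ne_zero [ConnectedSpace M] (h : RecurrentWith g η)
    (hη : SmoothOneFormOn η Set.univ) (hne : ∃ p, ricciNormSq g p ≠ 0) (p : M) :
    ricciNormSq g p ≠ 0 := by
  refine forall_ne_zero_of_pderiv_eq_mul (n := n) (fun p => ?_) hne p
  set e := chartAt (EuclideanSpace ℝ (Fin n)) p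
  have hc : e ∈ IsManifold.maximalAtlas (𝓡 n) ∞ M := IsManifold.chart_mem_maximalAtlas p
  have hG := isMetricOn_metricCoeff g hc
  have heq : Set.EqOn (fun z => ricciNormSq g (e.symm z)) (ricNormSq (metricCoeff g e)) e.target :=
    fun z hz => ricciNormSq_eq g hc hz
  refine ⟨fun i z => 2 * formCoeff η e i z, fun i =>
    continuousOn_const.mul (contDiffOn_formCoeff hη hc i).continuousOn, fun z hz => ⟨?_, fun i => ?_⟩⟩
  · exact contDiffOn_differentiableAt e.open_target hz (hG.smooth_ricNormSq.congr heq)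
  · rw [pderiv_congr e.open_target hz heq, (h e hc).pderiv_ricNormSq hG hz,
      ricciNormSq_eq g hc hz]

/-- Both `|Ri|²` and `sc²` are multiplied by `2β` under differentiation, hence so is this
combination. It carries the non-Einstein property from one point to all. -/
theorem RecurrentWith.traceless_ne_zero [ConnectedSpace M] (h : RecurrentWith g η)
    (hη : SmoothOneFormOn η Set.univ)
    (hne : ∃ p, 3 * ricciNormSq g p - scalarCurvature g p ^ 2 ≠ 0) (p : M) :
    3 * ricciNormSq g p - scalarCurvature g p ^ 2 ≠ 0 := by
  refine forall_ne_zero_of_pderiv_eq_mul (n := n)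
    (f := fun p => 3 * ricciNormSq g p - scalarCurvature g p ^ 2) (fun p => ?_) hne p
  set e := chartAt (EuclideanSpace ℝ (Fin n)) p
  have hc : e ∈ IsManifold.maximalAtlas (𝓡 n) ∞ M := IsManifold.chart_mem_maximalAtlas p
  have hG := isMetricOn_metricCoeff g hc
  have heq : Set.EqOn
      (fun z => 3 * ricciNormSq g (e.symm z) - scalarCurvature g (e.symm z) ^ 2)
      (fun z => 3 * ricNormSq (metricCoeff g e) z -
        (ricUp (metricCoeff g e) z).trace * (ricUp (metricCoeff g e) z).trace) e.target :=
    fun z hz => by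
      simp only [ricciNormSq_eq g hc hz, scalarCurvature_eq g hc hz, sq]
  have hs1 := hG.smooth_ricNormSq
  have hs2 := hG.smooth_ricUp.trace
  refine ⟨fun i z => 2 * formCoeff η e i z, fun i =>
    continuousOn_const.mul (contDiffOn_formCoeff hη hc i).continuousOn, fun z hz => ⟨?_, fun i => ?_⟩⟩
  · exact contDiffOn_differentiableAt e.open_target hz
      (((contDiffOn_const.mul hs1).sub (hs2.mul hs2)).congr heq)
  · have d1 := contDiffOn_differentiableAt e.open_target hz hs1
    have d2 := contDiffOn_differentiableAt e.open_target hz hs2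
    have h3 := heq hz
    simp only at h3
    rw [pderiv_congr e.open_target hz heq, h3,
      pderiv_sub ((differentiableAt_const _).fun_mul d1) (d2.fun_mul d2),
      pderiv_mul (differentiableAt_const _) d1, pderiv_mul d2 d2, pderiv_const,
      (h e hc).pderiv_ricNormSq hG hz, (h e hc).pderiv_trace_ricUp hG hz]
    ring

/-- A nonvanishing Ricci tensor with recurrence form not identically zero is not quasi Einstein in
dimension greater than three. -/
theorem RecurrentWith.not_quasiEinstein (hn : 3 < n) (h : RecurrentWith g η)
    (hne : ∀ p, ricciNormSq g p ≠ 0) {p : M} (hp : η p ≠ 0) : ¬ QuasiEinstein g := by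
  rintro ⟨a, b, -, -, hq⟩
  obtain ⟨V, -, hpV, θ, -, -, hθ⟩ := hq p
  set e := chartAt (EuclideanSpace ℝ (Fin n)) p
  have hpe : p ∈ e.source := mem_chart_source _ p
  have hc : e ∈ IsManifold.maximalAtlas (𝓡 n) ∞ M := IsManifold.chart_mem_maximalAtlas p
  have hG := isMetricOn_metricCoeff g hc
  have hy := e.map_source hpe
  have hpos : ∀ z ∈ e.target, 0 < ricNormSq (metricCoeff g e) z := fun z hz =>
    (hG.ricNormSq_nonneg hz).lt_of_ne' (by rw [← ricciNormSq_eq g hc hz]; exact hne _)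
  have hβ : (fun l => formCoeff η e l (e p)) ≠ 0 := by
    intro h0
    have h1 := eq_zero_of_formCoeff hc hy fun i => congrFun h0 i
    rw [e.left_inv hpe] at h1
    exact hp h1
  -- At the single point `p`, where the recurrence form is nonzero; the factor `1/|θ|²` is absorbed
  -- into `b`.
  have h0 := ricci_eq_zero_of_quasiEinstein hn (hG.posDef _ hy) (hG.curv_skew hy)
    ((h e hc).curv_ricMat hG hy hpos) ricMat_apply hβ ((h e hc).eigen_smul hG hy)
    (a := a p) (b := b p / formNormSq g θ e (e p)) (η := fun i => formCoeff θ e i (e p)) (by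
      ext i j
      have h2 := hθ e hc (e p) hy (by rwa [e.left_inv hpe]) i j
      rw [e.left_inv hpe] at h2
      simp only [Matrix.add_apply, Matrix.smul_apply, Matrix.vecMulVec_apply, smul_eq_mul]
      refine h2.trans ?_
      ring)
  have h3 := hpos _ hy
  rw [ricNormSq, ricUp, h0] at h3
  simp at h3

end Global

/-! ### The normal form of the Ricci tensor in dimension three -/

section DimensionThree

variable {M : Type*} [TopologicalSpace M] [ChartedSpace (EuclideanSpace ℝ (Fin 3)) M]
  [IsManifold (𝓡 3) ∞ M] {e : OpenPartialHomeomorph M (EuclideanSpace ℝ (Fin 3))}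
  {y : EuclideanSpace ℝ (Fin 3)} {g : Metric 3 M} {η : ∀ p : M, TangentSpace (𝓡 3) p →L[ℝ] ℝ}

/-- The eigenvector equation excludes the Einstein case only where `η ≠ 0`; `traceless_ne_zero`
extends this to zeros of `η`, and `ricci_dim_three` then applies at every point. -/
theorem RecurrentWith.shape [ConnectedSpace M] (h : RecurrentWith g η)
    (hη : SmoothOneFormOn η Set.univ) (hη0 : ∃ p, η p ≠ 0) (hne : ∀ p, ricciNormSq g p ≠ 0)
    (he : e ∈ IsManifold.maximalAtlas (𝓡 3) ∞ M) (hy : y ∈ e.target) :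
    (ricUp (metricCoeff g e) y).trace ≠ 0 ∧ ∃ w : Fin 3 → ℝ, ∀ i j,
      ricMat (metricCoeff g e) y i j =
        (ricUp (metricCoeff g e) y).trace / 2 * (metricCoeff g e y i j - w i * w j) := by
  have hnt : ∀ p, 3 * ricciNormSq g p - scalarCurvature g p ^ 2 ≠ 0 := by
    obtain ⟨p, hp⟩ := hη0
    refine h.traceless_ne_zero hη ⟨p, ?_⟩
    set e := chartAt (EuclideanSpace ℝ (Fin 3)) p
    have hpe : p ∈ e.source := mem_chart_source _ p
    have hc : e ∈ IsManifold.maximalAtlas (𝓡 3) ∞ M := IsManifold.chart_mem_maximalAtlas p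
    have hG := isMetricOn_metricCoeff g hc
    have hy := e.map_source hpe
    have hβ : (fun l => formCoeff η e l (e p)) ≠ 0 := by
      intro h0
      have h1 := eq_zero_of_formCoeff hc hy fun i => congrFun h0 i
      rw [e.left_inv hpe] at h1
      exact hp h1
    have h1 := ricciNormSq_eq g hc hy
    have h2 := scalarCurvature_eq g hc hy
    rw [e.left_inv hpe] at h1 h2
    rw [h1, h2]
    exact trace_sq_sub_ne_zero (hG.posDef _ hy) (hG.ricMat_symm hy) hβ
      ((h e hc).eigen_smul hG hy) (by have := hne p; rwa [h1] at this)
  have hG := isMetricOn_metricCoeff g he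
  have hpos : ∀ z ∈ e.target, 0 < ricNormSq (metricCoeff g e) z := fun z hz =>
    (hG.ricNormSq_nonneg hz).lt_of_ne' (by rw [← ricciNormSq_eq g he hz]; exact hne _)
  have h1 := hnt (e.symm y)
  rw [ricciNormSq_eq g he hy, scalarCurvature_eq g he hy] at h1
  exact ricci_dim_three (hG.posDef _ hy) (hG.ricMat_symm hy) (fun i j => curv_antisymm i j)
    (hG.curv_skew hy) ((h e he).curv_ricMat hG hy hpos) ricMat_apply h1

/-- The shape of the Ricci tensor in terms of a one-form, at a point of a chart. -/
def HasShape (g : Metric 3 M) (θ : ∀ p : M, TangentSpace (𝓡 3) p →L[ℝ] ℝ)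
    (e : OpenPartialHomeomorph M (EuclideanSpace ℝ (Fin 3))) (y : EuclideanSpace ℝ (Fin 3)) :
    Prop :=
  ricMat (metricCoeff g e) y = (scalarCurvature g (e.symm y) / 2) • (metricCoeff g e y -
    (formNormSq g θ e y)⁻¹ •
      Matrix.vecMulVec (fun i => formCoeff θ e i y) fun i => formCoeff θ e i y)

theorem formNormSq_eq_dotProduct (g : Metric 3 M) (θ : ∀ p : M, TangentSpace (𝓡 3) p →L[ℝ] ℝ) :
    formNormSq g θ e y = (fun i => formCoeff θ e i y) ⬝ᵥ
      ((metricCoeff g e y)⁻¹ *ᵥ fun i => formCoeff θ e i y) := by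
  simp only [formNormSq, dotProduct, Matrix.mulVec, Finset.mul_sum]
  exact Finset.sum_congr rfl fun i _ => Finset.sum_congr rfl fun j _ => by ring

/-- Both sides are tensors and `|θ|²` is a scalar, so the form built in one chart serves in every
chart of the atlas. -/
theorem HasShape.transition {θ : ∀ p : M, TangentSpace (𝓡 3) p →L[ℝ] ℝ}
    {e' : OpenPartialHomeomorph M (EuclideanSpace ℝ (Fin 3))}
    (he : e ∈ IsManifold.maximalAtlas (𝓡 3) ∞ M) (he' : e' ∈ IsManifold.maximalAtlas (𝓡 3) ∞ M)
    (hy : y ∈ overlap e' e) (h : HasShape g θ e (transition e' e y)) : HasShape g θ e' y := by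
  have hP := isPullbackOn_metricCoeff g he he'
  set J := jac (RicciGeometry.transition e' e) y
  set v : Fin 3 → ℝ := fun i => formCoeff θ e i (RicciGeometry.transition e' e y)
  have hv : (fun i => formCoeff θ e' i y) = Jᵀ *ᵥ v := by
    funext i
    exact formCoeff_transition θ he he' hy i
  have hN : formNormSq g θ e' y = formNormSq g θ e (RicciGeometry.transition e' e y) := by
    rw [formNormSq_eq_dotProduct, formNormSq_eq_dotProduct, hv, hP.inv_eq hy,
      Matrix.mulVec_mulVec, mul_assoc, hP.inv_transpose_mul hy, mul_one, Matrix.mulVec_transpose,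
      ← Matrix.dotProduct_mulVec, Matrix.mulVec_mulVec, ← mul_assoc,
      Matrix.mul_nonsing_inv _ (hP.det_jac hy), one_mul]
  rw [HasShape, symm_transition hy] at h
  rw [HasShape, hP.ricMat_eq hy, h, hP.eq y hy, hN, hv]
  simp only [mul_sub, sub_mul, mul_smul_comm, smul_mul_assoc, Matrix.mul_vecMulVec,
    Matrix.vecMulVec_mul, Matrix.mulVec_transpose]
  rfl

/-- The pointwise covector `w` comes with no smooth choice of sign, but `w ⊗ w` is the smooth tensor
`T`. Its `k`-th column is `w_k w`, which spans the same line and is nonzero where `T_kk = w_k²` is.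
-/
theorem RecurrentWith.exists_hasShape [ConnectedSpace M] (h : RecurrentWith g η)
    (hη : SmoothOneFormOn η Set.univ) (hη0 : ∃ p, η p ≠ 0) (hne : ∀ p, ricciNormSq g p ≠ 0)
    (p : M) : ∃ U : Set M, IsOpen U ∧ p ∈ U ∧ ∃ θ : ∀ q : M, TangentSpace (𝓡 3) q →L[ℝ] ℝ,
      SmoothOneFormOn θ U ∧ (∀ q ∈ U, θ q ≠ 0) ∧
      ∀ e ∈ IsManifold.maximalAtlas (𝓡 3) ∞ M, ∀ y ∈ e.target, e.symm y ∈ U →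
        HasShape g θ e y := by
  set e := chartAt (EuclideanSpace ℝ (Fin 3)) p with hedef
  have hpe : p ∈ e.source := mem_chart_source _ p
  have hc : e ∈ IsManifold.maximalAtlas (𝓡 3) ∞ M := IsManifold.chart_mem_maximalAtlas p
  have hG := isMetricOn_metricCoeff g hc
  set G := metricCoeff g e
  have hsh := fun z (hz : z ∈ e.target) => h.shape hη hη0 hne hc hz
  set t : EuclideanSpace ℝ (Fin 3) → ℝ := fun z => (ricUp G z).trace
  have ht : ∀ z ∈ e.target, t z ≠ 0 := fun z hz => (hsh z hz).1
  set T : EuclideanSpace ℝ (Fin 3) → Matrix (Fin 3) (Fin 3) ℝ :=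
    fun z => G z - (2 / t z) • ricMat G z with hT
  have hTs : MSmoothOn T e.target := hG.smooth.sub
    (MSmoothOn.smul (contDiffOn_const.div hG.smooth_ricUp.trace ht) hG.smooth_ricMat)
  have hw : ∀ z ∈ e.target, ∃ w : Fin 3 → ℝ, (∀ i j, T z i j = w i * w j) ∧
      w ⬝ᵥ ((G z)⁻¹ *ᵥ w) = 1 := by
    intro z hz
    obtain ⟨h0, w, hw⟩ := hsh z hz
    refine ⟨w, fun i j => ?_, ?_⟩
    · simp only [hT, Matrix.sub_apply, Matrix.smul_apply, smul_eq_mul]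
      rw [show ricMat G z i j = t z / 2 * (G z i j - w i * w j) from hw i j]
      field_simp [ht z hz]
      ring
    · have hS : ricMat G z = (t z / 2) • (G z - Matrix.vecMulVec w w) := by
        ext i j
        simpa [Matrix.vecMulVec_apply] using hw i j
      -- Taking the trace of the normal form shows that `|w| = 1`.
      have h1 : t z = t z / 2 * (3 - w ⬝ᵥ ((G z)⁻¹ *ᵥ w)) := by
        conv_lhs => rw [show t z = (ricMat G z * (G z)⁻¹).trace from rfl, hS]
        rw [smul_mul_assoc, sub_mul, hG.mul_inv hz, Matrix.trace_smul, Matrix.trace_sub,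
          Matrix.trace_one, Matrix.vecMulVec_mul, Matrix.trace_vecMulVec,
          ← Matrix.mulVec_transpose, hG.inv_symm hz]
        simp
      have h2 : t z * (w ⬝ᵥ ((G z)⁻¹ *ᵥ w) - 1) = 0 := by linarith
      linarith [(mul_eq_zero.1 h2).resolve_left (ht z hz)]
  -- The diagonal entries are the squares of the components of a unit covector, so they cannot all
  -- vanish.
  obtain ⟨k, hk⟩ : ∃ k, T (e p) k k ≠ 0 := by
    obtain ⟨w, hw1, hw2⟩ := hw (e p) (e.map_source hpe)
    by_contra! h0
    have h1 : w = 0 := by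
      funext i
      have := h0 i
      rw [hw1] at this
      simpa using this
    rw [h1] at hw2
    simp at hw2
  set s := e.target ∩ {z | T z k k ≠ 0}
  have hs : IsOpen s := (hTs k k).continuousOn.isOpen_inter_preimage e.open_target
    isOpen_compl_singleton
  set c : Fin 3 → EuclideanSpace ℝ (Fin 3) → ℝ := fun i z => T z i k with hcdef
  have hcoef : ∀ z ∈ e.target, (fun i => formCoeff (chartForm e c) e i z) = fun i => c i z :=
    fun z hz => funext fun i => formCoeff_chartForm hc hz c i
  have hshape : ∀ z ∈ s, HasShape g (chartForm e c) e z := by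
    rintro z ⟨hz, hzk⟩
    obtain ⟨w, hw1, hw2⟩ := hw z hz
    have hck : (fun i => c i z) = w k • w := by
      funext i
      simp only [hcdef, hw1, Pi.smul_apply, smul_eq_mul]
      ring
    have hwk : w k ≠ 0 := by
      intro h0
      apply hzk
      rw [hw1, h0, zero_mul]
    have hN : formNormSq g (chartForm e c) e z = w k * w k := by
      rw [formNormSq_eq_dotProduct, hcoef z hz, hck, Matrix.mulVec_smul, smul_dotProduct,
        dotProduct_smul, hw2]
      simp
    rw [HasShape, hN, hcoef z hz, hck, scalarCurvature_eq g hc hz]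
    ext i j
    have h1 : ricMat G z i j = t z / 2 * (G z i j - T z i j) := by
      simp only [hT, Matrix.sub_apply, Matrix.smul_apply, smul_eq_mul]
      field_simp [ht z hz]
      ring
    change ricMat G z i j = t z / 2 * (G z i j - (w k * w k)⁻¹ * ((w k * w i) * (w k * w j)))
    rw [h1, hw1]
    field_simp
  refine ⟨e.source ∩ e ⁻¹' s, e.isOpen_inter_preimage hs, ⟨hpe, e.map_source hpe, hk⟩,
    chartForm e c, smoothOneFormOn_chartForm hc hs fun i => (hTs i k).mono Set.inter_subset_left,
    fun q hq h0 => ?_, fun e' he' y hy hyU => ?_⟩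
  · apply hq.2.2
    have h1 := formCoeff_chartForm hc hq.2.1 c k
    have h2 : formCoeff (chartForm e c) e k (e q) = 0 := by
      have h3 : chartForm e c (e.symm (e q)) = 0 := by rw [e.left_inv hq.1]; exact h0
      rw [formCoeff, h3]
      rfl
    rw [h2] at h1
    exact h1.symm
  · exact HasShape.transition hc he' ⟨hy, hyU.1⟩ (hshape _ hyU.2)

theorem HasShape.ricci_eq {θ : ∀ p : M, TangentSpace (𝓡 3) p →L[ℝ] ℝ} (h : HasShape g θ e y)
    (i j : Fin 3) : ricci (metricCoeff g e) i j y = scalarCurvature g (e.symm y) / 2 *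
      (metricCoeff g e y i j - formCoeff θ e i y * formCoeff θ e j y / formNormSq g θ e y) := by
  have h1 := congrFun (congrFun h i) j
  simp only [Matrix.smul_apply, Matrix.sub_apply, Matrix.vecMulVec_apply, smul_eq_mul] at h1
  refine h1.trans ?_
  ring

end DimensionThree

end RicciGeometry

end

/-! ### The theorem -/

theorem mainTheorem5 (n : ℕ) {M : Type*} [TopologicalSpace M]
    [ChartedSpace (EuclideanSpace ℝ (Fin n)) M] [IsManifold (𝓡 n) ∞ M] [ConnectedSpace M]
    (g : RicciGeometry.Metric n M) (hRi : RicciGeometry.RicciNonzero g) :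
    (n = 3 → RicciGeometry.RicciRecurrent g →
      RicciGeometry.QuasiEinstein g ∧
      (∀ p : M, RicciGeometry.scalarCurvature g p ≠ 0) ∧
      ∀ p : M, ∃ U : Set M, IsOpen U ∧ p ∈ U ∧
        ∃ η : ∀ q : M, TangentSpace (𝓡 n) q →L[ℝ] ℝ,
          RicciGeometry.SmoothOneFormOn η U ∧ (∀ q ∈ U, η q ≠ 0) ∧
          ∀ e ∈ IsManifold.maximalAtlas (𝓡 n) ∞ M, ∀ y ∈ e.target, e.symm y ∈ U → ∀ i j,
            RicciGeometry.ricci (RicciGeometry.metricCoeff g e) i j y =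
              RicciGeometry.scalarCurvature g (e.symm y) / 2 *
                (RicciGeometry.metricCoeff g e y i j -
                  RicciGeometry.formCoeff η e i y * RicciGeometry.formCoeff η e j y /
                    RicciGeometry.formNormSq g η e y)) ∧
    (3 < n → ¬ (RicciGeometry.RicciRecurrent g ∧ RicciGeometry.QuasiEinstein g)) := by
  have hpt : ∃ p, RicciGeometry.ricciNormSq g p ≠ 0 := by
    obtain ⟨e, he, y, hy, i, j, hij⟩ := hRi
    refine ⟨e.symm y, fun h => hij ?_⟩
    rw [RicciGeometry.ricciNormSq_eq g he hy] at h
    exact congrFun (congrFun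
      ((RicciGeometry.isMetricOn_metricCoeff g he).ricMat_eq_zero hy h) i) j
  refine ⟨?_, ?_⟩
  · rintro rfl ⟨β, hβ, hβ0, hrec⟩
    have hR : RicciGeometry.RecurrentWith g β := fun e he =>
      RicciGeometry.recurrentOn_of_covDerivRicci (hrec e he)
    have hne := hR.ricciNormSq_ne_zero hβ hpt
    have hshape := hR.exists_hasShape hβ hβ0 hne
    refine ⟨⟨fun p => RicciGeometry.scalarCurvature g p / 2,
      fun p => -(RicciGeometry.scalarCurvature g p / 2), ?_, ?_, fun p => ?_⟩, fun p => ?_,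
      fun p => ?_⟩
    · exact (RicciGeometry.contMDiff_scalarCurvature g).div_const _
    · exact ((RicciGeometry.contMDiff_scalarCurvature g).div_const _).neg
    · obtain ⟨U, hU, hpU, θ, hθ, hθ0, h⟩ := hshape p
      refine ⟨U, hU, hpU, θ, hθ, hθ0, fun e he y hy hyU i j => ?_⟩
      rw [(h e he y hy hyU).ricci_eq i j]
      ring
    · have hc := IsManifold.chart_mem_maximalAtlas (I := 𝓡 3) (n := ∞) p
      have h1 := (hR.shape hβ hβ0 hne hc (mem_chart_target _ p)).1
      rwa [← RicciGeometry.scalarCurvature_eq g hc (mem_chart_target _ p),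
        OpenPartialHomeomorph.left_inv _ (mem_chart_source _ p)] at h1
    · obtain ⟨U, hU, hpU, θ, hθ, hθ0, h⟩ := hshape p
      exact ⟨U, hU, hpU, θ, hθ, hθ0, fun e he y hy hyU => (h e he y hy hyU).ricci_eq⟩
  · rintro hn ⟨⟨β, hβ, ⟨p, hp⟩, hrec⟩, hq⟩
    have hR : RicciGeometry.RecurrentWith g β := fun e he =>
      RicciGeometry.recurrentOn_of_covDerivRicci (hrec e he)
    exact hR.not_quasiEinstein hn (hR.ricciNormSq_ne_zero hβ hpt) hp hq
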